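/- Consider Jacobi's system for holomorphic functions $A,B,a,b$ of a complex variable $h$, $$A'=2A^2B,\qquad B'=bA^3,\qquad a'=-16\,bA^2,\qquad b'=abA^2 ,$$ and, for $\Im\tau>0$, the functions $$\vartheta_2(\tau)=e^{\frac{\pi i\tau}{4}}\sum_{k\in\mathbb Z}e^{(k^2+k)\pi i\tau},\quad \vartheta_3(\tau)=\sum_{k\in\mathbb Z}e^{k^2\pi i\tau},\quad \vartheta_4(\tau)=\sum_{k\in\mathbb Z}(-1)^ke^{k^2\pi i\tau},\quad \eta(\tau)=2\pi^2\Big\{\frac1{24}-\sum_{k\ge1}\frac{e^{2k\pi i\tau}}{(1-e^{2k\pi i\tau})^2}\Big\}.$$ For complex constants $I\ne0$, $\alpha,\beta,\gamma,\delta$ with $\alpha\delta-\beta\gamma=1$ put $\mathbb T=\frac{\alpha h+\beta}{\gamma h+\delta}$, let $D=\{h\in\mathbb C:\gamma h+\delta\neq0,\ \Im\mathbb T>0\}$, and on $D$ set $$a=I-2I\,\frac{\vartheta_2^4(\mathbb T)}{\vartheta_3^4(\mathbb T)},\qquad b=\frac{I^2}{8}\,\frac{\vartheta_2^4(\mathbb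 T)\,\vartheta_4^4(\mathbb T)}{\vartheta_3^8(\mathbb T)},\qquad A=\pm\sqrt{\frac{\pi i}{I}}\,\frac{\vartheta_3^2(\mathbb T)}{\gamma h+\delta},$$ $$B=\pm\sqrt{\frac{iI}{\pi^3}}\,\frac{1}{(\gamma h+\delta)\,\vartheta_3^2(\mathbb T)}\Big\{\frac{\pi^2}{12}\big[\vartheta_2^4(\mathbb T)-\vartheta_4^4(\mathbb T)\big]+\eta(\mathbb T)+\frac{\pi}{2}\,i\gamma(\gamma h+\delta)\Big\},$$ where the two square roots, signs included, are chosen so that their product is $i/\pi$. These formulas give the general solution of the system, in the following sense. (i) For every choice of the constants (and of the sign) the set $D$ is nonempty, $(A,B,a,b)$ is a solution on $D$, and on $D$ one has $a^2+32b=I^2$, $A\ne0$ and $b\neq0$. (ii) Let $(A,B,a,b)$ be a solution on a connected open set $U\subseteq\mathbb C$ such that $A$, $b$ and $a^2+32b$ are all nonzero at some point of $U$. Then there are constants $I\neq0$, $\alpha,\beta,\gamma,\delta$ with $\alpha\delta-\beta\gamma=1$, and a choice of the sign, such that $U\subseteq D$, and on all of $U$ one has $I^2=a^2+32b$ and $a,b,A,B$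 are given by the formulas above. -/

import Mathlib

noncomputable section

namespace JacobiSystem

open Complex

/-- The theta-constant `ϑ₂(τ) = e^{πiτ/4} ∑_{k ∈ ℤ} e^{(k²+k)πiτ}` (used for `Im τ > 0`). -/
def theta2 (τ : ℂ) : ℂ :=
  cexp (Real.pi * I * τ / 4) * ∑' k : ℤ, cexp (((k : ℂ) ^ 2 + k) * (Real.pi * I * τ))

/-- The theta-constant `ϑ₃(τ) = ∑_{k ∈ ℤ} e^{k²πiτ}` (used for `Im τ > 0`). -/
def theta3 (τ : ℂ) : ℂ :=
  ∑' k : ℤ, cexp ((k : ℂ) ^ 2 * (Real.pi * I * τ))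

/-- The theta-constant `ϑ₄(τ) = ∑_{k ∈ ℤ} (-1)^k e^{k²πiτ}` (used for `Im τ > 0`). -/
def theta4 (τ : ℂ) : ℂ :=
  ∑' k : ℤ, (-1 : ℂ) ^ k * cexp ((k : ℂ) ^ 2 * (Real.pi * I * τ))

/-- The Weierstrass eta-function
`η(τ) = 2π² (1/24 - ∑_{k ≥ 1} e^{2kπiτ} / (1 - e^{2kπiτ})²)` (used for `Im τ > 0`). -/
def weierstrassEta (τ : ℂ) : ℂ :=
  2 * (Real.pi : ℂ) ^ 2 * (1 / 24 - ∑' k : ℕ+,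
    cexp (2 * k * (Real.pi * I * τ)) / (1 - cexp (2 * k * (Real.pi * I * τ))) ^ 2)

/-- `(A, B, a, b)` is a (holomorphic) solution on `U` of Jacobi's dynamical system
`A' = 2A²B`, `B' = bA³`, `a' = -16bA²`, `b' = abA²`. -/
def IsSolutionOn (U : Set ℂ) (A B a b : ℂ → ℂ) : Prop :=
  ∀ h ∈ U,
    HasDerivAt A (2 * A h ^ 2 * B h) h ∧
    HasDerivAt B (b h * A h ^ 3) h ∧
    HasDerivAt a (-16 * b h * A h ^ 2) h ∧
    HasDerivAt b (a h * b h * A h ^ 2) h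

/-- The linear fractional expression `T = (αh + β) / (γh + δ)`. -/
def mobius (α β γ δ h : ℂ) : ℂ := (α * h + β) / (γ * h + δ)

/-- The set of times `h` at which `T = (αh + β) / (γh + δ)` is finite and lies in the open
upper half-plane. -/
def timeDomain (α β γ δ : ℂ) : Set ℂ :=
  {h | γ * h + δ ≠ 0 ∧ 0 < (mobius α β γ δ h).im}

/-- `ρ = ±√(πi/c)` and `σ = ±√(ic/π³)`, the two signs being matched by `ρσ = i/π`. -/
def IsRootPair (c ρ σ : ℂ) : Prop :=
  ρ ^ 2 = Real.pi * I / c ∧ σ ^ 2 = I * c / (Real.pi : ℂ) ^ 3 ∧ ρ * σ = I / Real.pi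

/-- The component `a = c - 2c ϑ₂⁴(T) / ϑ₃⁴(T)`. -/
def sola (c α β γ δ h : ℂ) : ℂ :=
  c - 2 * c * (theta2 (mobius α β γ δ h) ^ 4 / theta3 (mobius α β γ δ h) ^ 4)

/-- The component `b = (c²/8) ϑ₂⁴(T) ϑ₄⁴(T) / ϑ₃⁸(T)`. -/
def solb (c α β γ δ h : ℂ) : ℂ :=
  c ^ 2 / 8 * (theta2 (mobius α β γ δ h) ^ 4 * theta4 (mobius α β γ δ h) ^ 4 /
    theta3 (mobius α β γ δ h) ^ 8)

/-- The component `A = ρ ϑ₃²(T) / (γh + δ)`. -/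
def solA (ρ α β γ δ h : ℂ) : ℂ :=
  ρ * (theta3 (mobius α β γ δ h) ^ 2 / (γ * h + δ))

/-- The component
`B = σ / ((γh + δ) ϑ₃²(T)) · {(π²/12) [ϑ₂⁴(T) - ϑ₄⁴(T)] + η(T) + (π/2) i γ (γh + δ)}`. -/
def solB (σ α β γ δ h : ℂ) : ℂ :=
  σ * (1 / ((γ * h + δ) * theta3 (mobius α β γ δ h) ^ 2)) *
    ((Real.pi : ℂ) ^ 2 / 12 *
        (theta2 (mobius α β γ δ h) ^ 4 - theta4 (mobius α β γ δ h) ^ 4) +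
      weierstrassEta (mobius α β γ δ h) + Real.pi / 2 * I * γ * (γ * h + δ))

end JacobiSystem

end

namespace JacobiSystem

open Complex Filter Topology

/-! ### The theta constants as values of `jacobiTheta₂` -/

/-! Write `T` for the Möbius image of `h`, and `l` for the logarithmic derivative of ϑ₃. That the
formulas solve the system comes down to Jacobi's identity, the two relations giving the differences
of logarithmic derivatives of theta constants as ±(πi/4)·ϑ⁴, the Riccati equation l' = 2l² −
(π²/8)ϑ₂⁴ϑ₄⁴, and the expression of `l` through the Weierstrass η. The differential relations come
from doubling: by the duplication formulas a suitable normalised quantity takes the same value at τ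
and 2τ, hence equals its limit at the cusp (`eq_of_comp_two_mul_eq`). The link with η is modular:
(ϑ₂ϑ₃ϑ₄)⁸ is a cusp form of weight 12 and level one, so a multiple of the 24th power of the Dedekind
eta-function, and its logarithmic derivative is a multiple of E₂.

For the converse, nondegenerate initial values at one point are matched by a theta solution
(`exists_solution_parameters`). The value of `a` prescribes λ(T) = ϑ₂⁴/ϑ₃⁴, which can be any number
except 0 and 1 (`modularLambda_surjective`); `A` then fixes γh + δ, and `B` fixes γ. Uniqueness for
the differential equation propagates the agreement locally.

The remaining danger is that U might cross the boundary of the time domain (`eqOn_of_eq`). There a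
multiple of Klein's invariant at `T` is a function of b/c², so it stays bounded where b ≠ 0, and b
never vanishes because its equation is linear. Bounded invariant keeps the Petersson norm
|(ϑ₂ϑ₃ϑ₄)⁸|(Im T)⁶ away from zero. But this norm equals |const·A¹²b²|·Q⁶, with Q the continuous form
whose positivity defines the domain, so Q cannot tend to zero inside U. -/

lemma theta3_eq (τ : ℂ) : theta3 τ = jacobiTheta₂ 0 τ := by
  refine tsum_congr fun k => ?_
  simp only [jacobiTheta₂_term]
  congr 1; ring

lemma theta4_eq (τ : ℂ) : theta4 τ = jacobiTheta₂ (1 / 2) τ := by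
  refine tsum_congr fun k => ?_
  simp only [jacobiTheta₂_term]
  rw [← exp_pi_mul_I, ← exp_int_mul, ← Complex.exp_add]
  congr 1; ring

lemma theta2_eq (τ : ℂ) :
    theta2 τ = cexp (Real.pi * I * τ / 4) * jacobiTheta₂ (τ / 2) τ := by
  unfold theta2
  congr 1
  refine tsum_congr fun k => ?_
  simp only [jacobiTheta₂_term]
  congr 1; ring

lemma theta2_eq_tsum (τ : ℂ) :
    theta2 τ = ∑' k : ℤ, cexp (((k : ℂ) + 1 / 2) ^ 2 * (Real.pi * I * τ)) := by
  unfold theta2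
  rw [← tsum_mul_left]
  refine tsum_congr fun k => ?_
  rw [← Complex.exp_add]
  congr 1; ring

lemma differentiableAt_theta3 {τ : ℂ} (hτ : 0 < τ.im) : DifferentiableAt ℂ theta3 τ := by
  rw [funext theta3_eq]
  exact differentiableAt_jacobiTheta₂_snd 0 hτ

lemma differentiableAt_theta4 {τ : ℂ} (hτ : 0 < τ.im) : DifferentiableAt ℂ theta4 τ := by
  rw [funext theta4_eq]
  exact differentiableAt_jacobiTheta₂_snd (1 / 2) hτ

lemma differentiableAt_theta2 {τ : ℂ} (hτ : 0 < τ.im) : DifferentiableAt ℂ theta2 τ := by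
  rw [funext theta2_eq]
  have h := (hasFDerivAt_jacobiTheta₂ (τ / 2) hτ).differentiableAt
  have h2 : DifferentiableAt ℂ (fun t : ℂ => (t / 2, t)) τ := by fun_prop
  have h3 : DifferentiableAt ℂ (fun t : ℂ => jacobiTheta₂ (t / 2) t) τ :=
    DifferentiableAt.comp (f := fun t : ℂ => (t / 2, t))
      (g := fun p : ℂ × ℂ => jacobiTheta₂ p.1 p.2) τ h h2
  exact DifferentiableAt.mul (by fun_prop) h3

/-! ### Translation -/

lemma exp_int_sq_mul_pi_mul_I (k : ℤ) : cexp ((k : ℂ) ^ 2 * (Real.pi * I)) = (-1) ^ k := by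
  have h : cexp ((k : ℂ) ^ 2 * (Real.pi * I)) = (-1) ^ (k ^ 2) := by
    rw [← exp_pi_mul_I, ← exp_int_mul]; push_cast; rfl
  rw [h]
  rcases Int.even_or_odd k with hk | hk
  · rw [hk.neg_one_zpow, (hk.pow_of_ne_zero two_ne_zero).neg_one_zpow]
  · rw [hk.neg_one_zpow, hk.pow.neg_one_zpow]

lemma theta3_add_one (τ : ℂ) : theta3 (τ + 1) = theta4 τ := by
  refine tsum_congr fun k => ?_
  rw [← exp_int_sq_mul_pi_mul_I, ← Complex.exp_add]
  congr 1; ring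

lemma theta3_add_two (τ : ℂ) : theta3 (τ + 2) = theta3 τ := by
  rw [theta3_eq, theta3_eq, jacobiTheta₂_add_right]

lemma theta4_add_one (τ : ℂ) : theta4 (τ + 1) = theta3 τ := by
  rw [← theta3_add_one, ← theta3_add_two τ]
  congr 1; ring

lemma theta2_add_one (τ : ℂ) : theta2 (τ + 1) = cexp (Real.pi * I / 4) * theta2 τ := by
  unfold theta2
  rw [← mul_assoc, ← Complex.exp_add]
  congr 1
  · congr 1; ring
  · refine tsum_congr fun k => ?_
    obtain ⟨m, hm⟩ : ∃ m : ℤ, k ^ 2 + k = 2 * m := by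
      have : Even (k ^ 2 + k) := by
        rw [show k ^ 2 + k = k * (k + 1) by ring]; exact Int.even_mul_succ_self k
      obtain ⟨m, hm⟩ := this
      exact ⟨m, by omega⟩
    have hm' : (k : ℂ) ^ 2 + k = 2 * m := by exact_mod_cast hm
    rw [hm', show 2 * (m : ℂ) * (Real.pi * I * (τ + 1)) =
      2 * (m : ℂ) * (Real.pi * I * τ) + m * (2 * Real.pi * I) by ring, Complex.exp_add,
      exp_int_mul_two_pi_mul_I, mul_one]

lemma exp_pi_mul_I_div_four_pow_four : cexp (Real.pi * I / 4) ^ 4 = -1 := by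
  rw [← Complex.exp_nat_mul, ← exp_pi_mul_I]; congr 1; push_cast; ring

lemma theta2_add_one_pow_four (τ : ℂ) : theta2 (τ + 1) ^ 4 = -theta2 τ ^ 4 := by
  rw [theta2_add_one, mul_pow, exp_pi_mul_I_div_four_pow_four]; ring

/-! ### Inversion -/

lemma neg_I_mul_ne_zero {τ : ℂ} (hτ : 0 < τ.im) : -I * τ ≠ 0 := by
  have : τ ≠ 0 := by rintro rfl; simp at hτ
  simp [this]

lemma sqrt_factor_sq (τ : ℂ) :
    ((-I * τ) ^ (1 / 2 : ℂ)) ^ 2 = -I * τ := by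
  rw [← cpow_nat_mul]
  simp

lemma sqrt_factor_ne_zero {τ : ℂ} (hτ : 0 < τ.im) : (-I * τ) ^ (1 / 2 : ℂ) ≠ 0 := by
  intro h
  have := sqrt_factor_sq τ
  rw [h] at this
  exact neg_I_mul_ne_zero hτ (by rw [← this]; ring)

lemma sqrt_factor_pow_four (τ : ℂ) :
    ((-I * τ) ^ (1 / 2 : ℂ)) ^ 4 = -τ ^ 2 := by
  rw [show (4 : ℕ) = 2 * 2 from rfl, pow_mul, sqrt_factor_sq τ]
  linear_combination τ ^ 2 * I_sq

lemma theta3_inv {τ : ℂ} (hτ : 0 < τ.im) :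
    theta3 (-1 / τ) = (-I * τ) ^ (1 / 2 : ℂ) * theta3 τ := by
  have h := jacobiTheta₂_functional_equation 0 τ
  have h0 := sqrt_factor_ne_zero hτ
  rw [theta3_eq, theta3_eq, h]
  simp only [zero_div]
  rw [← mul_assoc, ← mul_assoc, mul_one_div_cancel h0]
  simp

lemma theta2_inv {τ : ℂ} (hτ : 0 < τ.im) :
    theta2 (-1 / τ) = (-I * τ) ^ (1 / 2 : ℂ) * theta4 τ := by
  have h := jacobiTheta₂_functional_equation (1 / 2) τ
  have h0 := sqrt_factor_ne_zero hτ
  rw [theta2_eq, theta4_eq, h, ← mul_assoc, ← mul_assoc, mul_one_div_cancel h0, one_mul,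
    ← jacobiTheta₂_neg_left]
  congr 2 <;> ring

lemma theta4_inv {τ : ℂ} (hτ : 0 < τ.im) :
    theta4 (-1 / τ) = (-I * τ) ^ (1 / 2 : ℂ) * theta2 τ := by
  have h := jacobiTheta₂_functional_equation (τ / 2) τ
  have h0 := sqrt_factor_ne_zero hτ
  have hτ0 : τ ≠ 0 := by rintro rfl; simp at hτ
  rw [theta2_eq, theta4_eq, h]
  rw [show τ / 2 / τ = 1 / 2 by field_simp,
    show -(Real.pi : ℂ) * I * (τ / 2) ^ 2 / τ = -(Real.pi * I * τ / 4) by field_simp; ring,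
    Complex.exp_neg]
  have := Complex.exp_ne_zero (Real.pi * I * τ / 4)
  field_simp

lemma im_neg_one_div_pos {τ : ℂ} (hτ : 0 < τ.im) : 0 < (-1 / τ).im := by
  have hτ0 : τ ≠ 0 := by rintro rfl; simp at hτ
  rw [neg_div, neg_im, one_div, inv_im, neg_div, neg_neg]
  exact div_pos hτ (normSq_pos.mpr hτ0)

/-! ### Duplication -/

/-- A pair (m, n) is (u+v, u−v) or (u+v+1, u−v) according to the parity of m + n. Under this
substitution m² + n² becomes twice a sum of two squares, which is the source of all the duplication
formulas. -/
lemma tsum_int_prod_parity {f : ℤ × ℤ → ℂ} (hf : Summable f) :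
    ∑' p, f p = ∑' p : ℤ × ℤ, f (p.1 + p.2, p.1 - p.2) +
      ∑' p : ℤ × ℤ, f (p.1 + p.2 + 1, p.1 - p.2) := by
  let i : ℤ × ℤ → ℤ × ℤ := fun p => (p.1 + p.2, p.1 - p.2)
  let j : ℤ × ℤ → ℤ × ℤ := fun p => (p.1 + p.2 + 1, p.1 - p.2)
  have hi : Function.Injective i := by
    rintro ⟨a, b⟩ ⟨c, d⟩ h
    simp only [i, Prod.mk.injEq] at h ⊢
    omega
  have hj : Function.Injective j := by
    rintro ⟨a, b⟩ ⟨c, d⟩ h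
    simp only [j, Prod.mk.injEq] at h ⊢
    omega
  have hij : IsCompl (Set.range i) (Set.range j) := by
    rw [isCompl_iff]
    constructor
    · rw [Set.disjoint_left]
      rintro _ ⟨⟨a, b⟩, rfl⟩ ⟨⟨c, d⟩, h⟩
      simp only [i, j, Prod.mk.injEq] at h
      omega
    · rw [codisjoint_iff_le_sup]
      rintro ⟨m, n⟩ -
      simp only [Set.sup_eq_union, Set.mem_union, Set.mem_range, i, j, Prod.mk.injEq,
        Prod.exists]
      rcases Int.even_or_odd' (m + n) with ⟨u, hu | hu⟩
      · exact Or.inl ⟨u, m - u, by omega, by omega⟩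
      · exact Or.inr ⟨u, m - u - 1, by omega, by omega⟩
  have h1 : HasSum (f ∘ ((↑) : Set.range i → ℤ × ℤ)) (∑' p, f (i p)) :=
    hi.hasSum_range_iff.mpr (hf.comp_injective hi).hasSum
  have h2 : HasSum (f ∘ ((↑) : Set.range j → ℤ × ℤ)) (∑' p, f (j p)) :=
    hj.hasSum_range_iff.mpr (hf.comp_injective hj).hasSum
  exact (h1.add_isCompl hij h2).tsum_eq

lemma summable_norm_theta3 {τ : ℂ} (hτ : 0 < τ.im) :
    Summable fun k : ℤ => ‖cexp ((k : ℂ) ^ 2 * (Real.pi * I * τ))‖ := by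
  refine ((summable_jacobiTheta₂_term_iff 0 τ).mpr hτ).norm.congr fun k => ?_
  simp only [jacobiTheta₂_term]
  congr 2; ring

lemma summable_norm_theta2 {τ : ℂ} (hτ : 0 < τ.im) :
    Summable fun k : ℤ => ‖cexp (((k : ℂ) + 1 / 2) ^ 2 * (Real.pi * I * τ))‖ := by
  refine (((summable_jacobiTheta₂_term_iff (τ / 2) τ).mpr hτ).norm.mul_left
    ‖cexp (Real.pi * I * τ / 4)‖).congr fun k => ?_
  simp only [jacobiTheta₂_term]
  rw [← norm_mul, ← Complex.exp_add]
  congr 2; ring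

lemma two_mul_im_pos {τ : ℂ} (hτ : 0 < τ.im) : 0 < (2 * τ).im := by
  simp [hτ]

/-- Even pairs give 2u² + 2v² in the exponent; odd pairs give 2(u+½)² + 2(v+½)². -/
lemma theta3_sq {τ : ℂ} (hτ : 0 < τ.im) :
    theta3 τ ^ 2 = theta3 (2 * τ) ^ 2 + theta2 (2 * τ) ^ 2 := by
  have h1 := summable_norm_theta3 hτ
  have h3 := summable_norm_theta3 (two_mul_im_pos hτ)
  have h2 := summable_norm_theta2 (two_mul_im_pos hτ)
  rw [pow_two, pow_two, pow_two, theta2_eq_tsum]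
  unfold theta3
  rw [tsum_mul_tsum_of_summable_norm h1 h1, tsum_mul_tsum_of_summable_norm h3 h3,
    tsum_mul_tsum_of_summable_norm h2 h2,
    tsum_int_prod_parity (summable_mul_of_summable_norm h1 h1)]
  congr 1 <;>
  · refine tsum_congr fun p => ?_
    rw [← Complex.exp_add, ← Complex.exp_add]
    congr 1; push_cast; ring

lemma theta4_sq {τ : ℂ} (hτ : 0 < τ.im) :
    theta4 τ ^ 2 = theta3 (2 * τ) ^ 2 - theta2 (2 * τ) ^ 2 := by
  have h : theta2 (2 * τ + 1 + 1) ^ 2 = -theta2 (2 * τ) ^ 2 := by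
    rw [theta2_add_one, theta2_add_one]
    linear_combination theta2 (2 * τ) ^ 2 * exp_pi_mul_I_div_four_pow_four
  rw [← theta3_add_one, theta3_sq (by simpa using hτ),
    show 2 * (τ + 1) = 2 * τ + 2 by ring, theta3_add_two,
    show 2 * τ + 2 = 2 * τ + 1 + 1 by ring, h]
  ring

lemma theta2_sq {τ : ℂ} (hτ : 0 < τ.im) :
    theta2 τ ^ 2 = 2 * (theta2 (2 * τ) * theta3 (2 * τ)) := by
  have h1 := summable_norm_theta2 hτ
  have h3 := summable_norm_theta3 (two_mul_im_pos hτ)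
  have h2 := summable_norm_theta2 (two_mul_im_pos hτ)
  rw [two_mul (theta2 (2 * τ) * theta3 (2 * τ))]
  nth_rw 2 [mul_comm (theta2 (2 * τ))]
  -- With half-integral indices, the even pairs give 2(u+½)² + 2v² and the odd ones 2(u+1)² +
  -- 2(v+½)², so one copy of the ϑ₃ series has to be shifted by one.
  have h3' : theta3 (2 * τ) =
      ∑' k : ℤ, cexp (((k : ℂ) + 1) ^ 2 * (Real.pi * I * (2 * τ))) := by
    rw [theta3, ← (Equiv.addRight (1 : ℤ)).tsum_eq]
    refine tsum_congr fun k => ?_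
    simp
  have h3s : Summable fun k : ℤ => ‖cexp (((k : ℂ) + 1) ^ 2 * (Real.pi * I * (2 * τ)))‖ := by
    refine ((Equiv.addRight (1 : ℤ)).summable_iff.mpr h3).congr fun k => ?_
    simp
  nth_rw 2 [h3']
  rw [pow_two, theta2_eq_tsum, theta2_eq_tsum, theta3]
  rw [tsum_mul_tsum_of_summable_norm h1 h1, tsum_mul_tsum_of_summable_norm h2 h3,
    tsum_mul_tsum_of_summable_norm h3s h2,
    tsum_int_prod_parity (summable_mul_of_summable_norm h1 h1)]
  congr 1 <;>
  · refine tsum_congr fun p => ?_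
    rw [← Complex.exp_add, ← Complex.exp_add]
    congr 1; push_cast; ring

/-- Jacobi's identity `ϑ₃⁴ = ϑ₂⁴ + ϑ₄⁴`. -/
lemma jacobi_identity {τ : ℂ} (hτ : 0 < τ.im) :
    theta3 τ ^ 4 = theta2 τ ^ 4 + theta4 τ ^ 4 := by
  have h2 := theta2_sq hτ
  have h3 := theta3_sq hτ
  have h4 := theta4_sq hτ
  rw [show theta3 τ ^ 4 = (theta3 τ ^ 2) ^ 2 by ring, show theta2 τ ^ 4 = (theta2 τ ^ 2) ^ 2 by ring,
    show theta4 τ ^ 4 = (theta4 τ ^ 2) ^ 2 by ring, h2, h3, h4]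
  ring

lemma theta4_two_mul_pow_four {τ : ℂ} (hτ : 0 < τ.im) :
    theta4 (2 * τ) ^ 4 = theta3 τ ^ 2 * theta4 τ ^ 2 := by
  rw [theta3_sq hτ, theta4_sq hτ]
  linear_combination -jacobi_identity (two_mul_im_pos hτ)

/-! ### Behaviour at the cusp -/

lemma norm_exp_sub_one_le {τ : ℂ} (hτ : 1 ≤ τ.im) {x : ℂ} {n : ℕ} (hx : (n : ℂ) = x) :
    ‖cexp (x * (Real.pi * I * τ))‖ ≤ Real.exp (-1) ^ n := by
  rw [← hx, Complex.norm_exp, ← Real.exp_nat_mul]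
  apply Real.exp_le_exp.mpr
  have : ((n : ℂ) * (Real.pi * I * τ)).re = -(n * (Real.pi * τ.im)) := by
    simp [mul_re, mul_im]
  rw [this]
  have hp : 1 ≤ Real.pi * τ.im := by nlinarith [Real.pi_gt_three]
  have hn : (0 : ℝ) ≤ n := Nat.cast_nonneg n
  nlinarith

lemma tendsto_exp_mul_nat {n : ℕ} (hn : n ≠ 0) :
    Tendsto (fun τ : ℂ => cexp ((n : ℂ) * (Real.pi * I * τ))) (comap im atTop) (𝓝 0) := by
  rw [tendsto_zero_iff_norm_tendsto_zero]
  have h : ∀ τ : ℂ, ‖cexp ((n : ℂ) * (Real.pi * I * τ))‖ = Real.exp (-(n * Real.pi * τ.im)) := by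
    intro τ
    rw [Complex.norm_exp]
    congr 1
    simp [mul_re, mul_im, mul_assoc]
  simp_rw [h]
  refine Real.tendsto_exp_neg_atTop_nhds_zero.comp ?_
  have hc : (0 : ℝ) < n * Real.pi := by positivity
  exact Tendsto.const_mul_atTop hc tendsto_comap

/-- A lacunary series `∑ e^{n(k) πiτ}` tends, at the cusp, to the number of `k` with `n(k) = 0`. -/
lemma tendsto_tsum_exp {n : ℤ → ℕ} (hn : ∀ k, k.natAbs ≤ n k + 1) :
    Tendsto (fun τ : ℂ => ∑' k : ℤ, cexp ((n k : ℂ) * (Real.pi * I * τ))) (comap im atTop)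
      (𝓝 (∑' k : ℤ, if n k = 0 then 1 else 0)) := by
  -- Since n(k) ≥ |k| − 1, each term is at most e·e^{−|k|} as soon as Im τ ≥ 1.
  have hs : Summable fun k : ℤ => Real.exp 1 * Real.exp (-1) ^ k.natAbs := by
    refine Summable.mul_left _ ?_
    exact Summable.of_nat_of_neg (by simp) (by simp)
  refine tendsto_tsum_of_dominated_convergence hs (fun k => ?_) ?_
  · split_ifs with h
    · simpa [h] using tendsto_const_nhds
    · exact tendsto_exp_mul_nat h
  · have : ∀ᶠ τ : ℂ in comap im atTop, 1 ≤ τ.im := tendsto_comap.eventually_ge_atTop 1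
    filter_upwards [this] with τ hτ k
    refine (norm_exp_sub_one_le hτ rfl).trans ?_
    rw [← Real.exp_nat_mul, ← Real.exp_nat_mul, ← Real.exp_add]
    apply Real.exp_le_exp.mpr
    have : ((k.natAbs : ℕ) : ℝ) ≤ n k + 1 := by exact_mod_cast hn k
    linarith

lemma tendsto_theta2_div :
    Tendsto (fun τ : ℂ => theta2 τ / cexp (Real.pi * I * τ / 4)) (comap im atTop) (𝓝 2) := by
  have hn : ∀ k : ℤ, ((k ^ 2 + k).toNat : ℤ) = k ^ 2 + k := fun k =>
    Int.toNat_of_nonneg (by nlinarith [Int.le_self_sq (-k)])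
  have h := tendsto_tsum_exp (n := fun k => (k ^ 2 + k).toNat) (fun k => by
    zify
    rw [hn]
    rcases abs_cases k with ⟨h, h'⟩ | ⟨h, h'⟩ <;> rw [h] <;> nlinarith)
  have hv : ∑' k : ℤ, (if (k ^ 2 + k).toNat = 0 then (1 : ℂ) else 0) = 2 := by
    rw [tsum_eq_sum (s := {0, -1})]
    · rw [Finset.sum_pair (by decide)]; norm_num
    · intro k hk
      simp only [Finset.mem_insert, Finset.mem_singleton, not_or] at hk
      rw [if_neg]
      intro h
      have := hn k
      rw [h] at this
      have : k * (k + 1) = 0 := by push_cast at this; linarith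
      rcases mul_eq_zero.mp this with h | h
      · exact hk.1 h
      · exact hk.2 (by omega)
  rw [hv] at h
  refine h.congr fun τ => ?_
  rw [theta2, mul_div_cancel_left₀ _ (Complex.exp_ne_zero _)]
  refine tsum_congr fun k => ?_
  congr 2
  exact_mod_cast hn k

lemma tendsto_theta3_sub_one_div :
    Tendsto (fun τ : ℂ => (theta3 τ - 1) / cexp (Real.pi * I * τ)) (comap im atTop) (𝓝 2) := by
  have hn : ∀ k : ℤ, k ≠ 0 → ((k ^ 2 - 1).toNat : ℤ) = k ^ 2 - 1 := fun k hk =>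
    Int.toNat_of_nonneg (by have := Int.one_le_abs hk; nlinarith [sq_abs k])
  -- The exponent at k = 0 is set to 1, a dummy term tending to zero that is subtracted again below;
  -- truncation of −1 to 0 would have added one to the limit.
  let n : ℤ → ℕ := fun k => if k = 0 then 1 else (k ^ 2 - 1).toNat
  have h := tendsto_tsum_exp (n := n) (fun k => by
    by_cases hk : k = 0
    · simp [hk]
    · simp only [n, if_neg hk]
      zify
      rw [hn k hk]
      have := Int.one_le_abs hk
      nlinarith [sq_abs k])
  have hv : ∑' k : ℤ, (if n k = 0 then (1 : ℂ) else 0) = 2 := by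
    rw [tsum_eq_sum (s := {1, -1})]
    · rw [Finset.sum_pair (by decide)]; norm_num [n]
    · intro k hk
      simp only [Finset.mem_insert, Finset.mem_singleton, not_or] at hk
      rw [if_neg]
      intro h
      by_cases hk0 : k = 0
      · simp [n, hk0] at h
      · simp only [n, if_neg hk0] at h
        have := hn k hk0
        rw [h] at this
        have : (k - 1) * (k + 1) = 0 := by push_cast at this; linarith
        rcases mul_eq_zero.mp this with h | h
        · exact hk.1 (by omega)
        · exact hk.2 (by omega)
  rw [hv] at h
  have h0 := tendsto_exp_mul_nat one_ne_zero
  have h' := h.sub h0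
  rw [sub_zero] at h'
  refine h'.congr' ?_
  have hpos : ∀ᶠ τ : ℂ in comap im atTop, 0 < τ.im := tendsto_comap.eventually_gt_atTop 0
  filter_upwards [hpos] with τ hτ
  have hs := (summable_norm_theta3 hτ).of_norm
  rw [eq_div_iff (Complex.exp_ne_zero _), sub_mul, ← tsum_mul_right, theta3,
    hs.tsum_eq_add_tsum_ite 0]
  have hterm : ∀ k : ℤ, cexp ((n k : ℂ) * (Real.pi * I * τ)) * cexp (Real.pi * I * τ) =
      (if k = 0 then 0 else cexp ((k : ℂ) ^ 2 * (Real.pi * I * τ))) +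
      (if k = 0 then cexp (Real.pi * I * τ) * cexp (Real.pi * I * τ) else 0) := by
    intro k
    by_cases hk : k = 0
    · simp [n, hk]
    · simp only [if_neg hk, add_zero, n]
      rw [← Complex.exp_add]
      have : (((k ^ 2 - 1).toNat : ℕ) : ℂ) = (k : ℂ) ^ 2 - 1 := by exact_mod_cast hn k hk
      rw [this]
      congr 1; ring
  have hs1 : Summable fun k : ℤ => (if k = 0 then 0 else cexp ((k : ℂ) ^ 2 * (Real.pi * I * τ))) := by
    refine (hs.sub (summable_of_hasFiniteSupport (f := fun k : ℤ => if k = 0 then (1 : ℂ) else 0)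
      ((Set.finite_singleton 0).subset fun k hk => by simpa using hk))).congr fun k => ?_
    by_cases hk : k = 0 <;> simp [hk]
  have hs2 : Summable fun k : ℤ =>
      (if k = 0 then cexp (Real.pi * I * τ) * cexp (Real.pi * I * τ) else 0) :=
    summable_of_hasFiniteSupport ((Set.finite_singleton 0).subset fun k hk => by
      by_contra h; simp at h hk; exact h hk)
  rw [tsum_congr hterm, hs1.tsum_add hs2, tsum_ite_eq]
  simp

lemma tendsto_add_one_cusp : Tendsto (fun τ : ℂ => τ + 1) (comap im atTop) (comap im atTop) := by
  rw [tendsto_comap_iff]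
  exact tendsto_comap.congr fun τ => by simp

lemma tendsto_two_pow_mul_cusp {τ : ℂ} (hτ : 0 < τ.im) :
    Tendsto (fun n : ℕ => (2 : ℂ) ^ n * τ) atTop (comap im atTop) := by
  rw [tendsto_comap_iff]
  have : (im ∘ fun n : ℕ => (2 : ℂ) ^ n * τ) = fun n : ℕ => (2 : ℝ) ^ n * τ.im := by
    ext n
    have : ((2 : ℂ) ^ n) = (((2 : ℝ) ^ n : ℝ) : ℂ) := by push_cast; rfl
    simp only [Function.comp_apply, this, im_ofReal_mul]
  rw [this]
  exact Tendsto.atTop_mul_const hτ (tendsto_pow_atTop_atTop_of_one_lt one_lt_two)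

lemma tendsto_theta4_sub_one_div :
    Tendsto (fun τ : ℂ => (theta4 τ - 1) / cexp (Real.pi * I * τ)) (comap im atTop)
      (𝓝 (-2)) := by
  refine (tendsto_theta3_sub_one_div.comp tendsto_add_one_cusp).neg.congr fun τ => ?_
  simp only [Function.comp_apply]
  rw [theta3_add_one, show (Real.pi : ℂ) * I * (τ + 1) = Real.pi * I * τ + Real.pi * I by ring,
    Complex.exp_add, exp_pi_mul_I]
  rw [mul_neg_one, div_neg, neg_neg]

lemma tendsto_exp_cusp :
    Tendsto (fun τ : ℂ => cexp (Real.pi * I * τ)) (comap im atTop) (𝓝 0) := by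
  simpa using tendsto_exp_mul_nat one_ne_zero

lemma tendsto_theta3 : Tendsto theta3 (comap im atTop) (𝓝 1) := by
  have h := (tendsto_theta3_sub_one_div.mul tendsto_exp_cusp).const_add 1
  simp only [mul_zero, add_zero] at h
  refine h.congr fun τ => ?_
  rw [div_mul_cancel₀ _ (Complex.exp_ne_zero _)]; ring

lemma tendsto_theta4 : Tendsto theta4 (comap im atTop) (𝓝 1) := by
  refine (tendsto_theta3.comp tendsto_add_one_cusp).congr fun τ => ?_
  simp [theta3_add_one]

lemma tendsto_theta2_pow_four_div :
    Tendsto (fun τ : ℂ => theta2 τ ^ 4 / cexp (Real.pi * I * τ)) (comap im atTop) (𝓝 16) := by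
  have h := tendsto_theta2_div.pow 4
  norm_num at h
  refine h.congr fun τ => ?_
  rw [div_pow, ← Complex.exp_nat_mul]
  congr 2; push_cast; ring

lemma tendsto_theta2_pow_four :
    Tendsto (fun τ : ℂ => theta2 τ ^ 4) (comap im atTop) (𝓝 0) := by
  have h := tendsto_theta2_pow_four_div.mul tendsto_exp_cusp
  rw [mul_zero] at h
  refine h.congr fun τ => ?_
  rw [div_mul_cancel₀ _ (Complex.exp_ne_zero _)]

/-! ### Nonvanishing -/

lemma two_pow_mul_im_pos {τ : ℂ} (hτ : 0 < τ.im) (n : ℕ) : 0 < ((2 : ℂ) ^ n * τ).im := by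
  induction n with
  | zero => simpa using hτ
  | succ n ih => rw [pow_succ', mul_assoc]; exact two_mul_im_pos ih

/-- By duplication a zero at τ forces zeros at all 2ⁿτ, whereas ϑ₄ tends to 1 at the cusp. -/
lemma theta4_ne_zero {τ : ℂ} (hτ : 0 < τ.im) : theta4 τ ≠ 0 := by
  intro h0
  have h : ∀ n : ℕ, theta4 ((2 : ℂ) ^ n * τ) = 0 := by
    intro n
    induction n with
    | zero => simpa using h0
    | succ n ih =>
      have := theta4_two_mul_pow_four (two_pow_mul_im_pos hτ n)
      rw [ih] at this
      rw [pow_succ', mul_assoc]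
      exact eq_zero_of_pow_eq_zero (n := 4) (by rw [this]; ring)
  have hlim := tendsto_theta4.comp (tendsto_two_pow_mul_cusp hτ)
  have h1 : (theta4 ∘ fun n : ℕ => (2 : ℂ) ^ n * τ) = fun _ => 0 := funext h
  rw [h1] at hlim
  exact zero_ne_one (tendsto_nhds_unique tendsto_const_nhds hlim)

lemma theta3_ne_zero {τ : ℂ} (hτ : 0 < τ.im) : theta3 τ ≠ 0 := by
  rw [← theta4_add_one]
  exact theta4_ne_zero (by simpa using hτ)

lemma theta2_ne_zero {τ : ℂ} (hτ : 0 < τ.im) : theta2 τ ≠ 0 := by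
  intro h
  have := theta4_inv hτ
  rw [h, mul_zero] at this
  exact theta4_ne_zero (im_neg_one_div_pos hτ) this

/-! ### Logarithmic derivatives of the theta constants -/

lemma isOpen_im_pos : IsOpen {τ : ℂ | 0 < τ.im} := isOpen_lt continuous_const continuous_im

lemma eventually_im_pos {τ : ℂ} (hτ : 0 < τ.im) : ∀ᶠ t in 𝓝 τ, 0 < t.im :=
  isOpen_im_pos.mem_nhds hτ

lemma hasDerivAt_unique_of_im_pos {f g : ℂ → ℂ} {f' g' τ : ℂ} (hτ : 0 < τ.im)
    (h : ∀ t : ℂ, 0 < t.im → f t = g t) (hf : HasDerivAt f f' τ) (hg : HasDerivAt g g' τ) :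
    f' = g' :=
  hf.unique (hg.congr_of_eventuallyEq ((eventually_im_pos hτ).mono h))

lemma hasDerivAt_theta2 {τ : ℂ} (hτ : 0 < τ.im) :
    HasDerivAt theta2 (logDeriv theta2 τ * theta2 τ) τ := by
  rw [logDeriv_apply, div_mul_cancel₀ _ (theta2_ne_zero hτ)]
  exact (differentiableAt_theta2 hτ).hasDerivAt

lemma hasDerivAt_theta3 {τ : ℂ} (hτ : 0 < τ.im) :
    HasDerivAt theta3 (logDeriv theta3 τ * theta3 τ) τ := by
  rw [logDeriv_apply, div_mul_cancel₀ _ (theta3_ne_zero hτ)]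
  exact (differentiableAt_theta3 hτ).hasDerivAt

lemma hasDerivAt_theta4 {τ : ℂ} (hτ : 0 < τ.im) :
    HasDerivAt theta4 (logDeriv theta4 τ * theta4 τ) τ := by
  rw [logDeriv_apply, div_mul_cancel₀ _ (theta4_ne_zero hτ)]
  exact (differentiableAt_theta4 hτ).hasDerivAt

lemma hasDerivAt_comp_two_mul {f : ℂ → ℂ} {f' τ : ℂ} (hf : HasDerivAt f f' (2 * τ)) :
    HasDerivAt (fun t => f (2 * t)) (f' * 2) τ := by
  have h : HasDerivAt (fun t : ℂ => 2 * t) 2 τ := by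
    simpa using (hasDerivAt_id τ).const_mul 2
  exact hf.comp τ h

lemma logDeriv_theta4_two_mul {τ : ℂ} (hτ : 0 < τ.im) :
    4 * logDeriv theta4 (2 * τ) = logDeriv theta3 τ + logDeriv theta4 τ := by
  have h2 := two_mul_im_pos hτ
  have h := hasDerivAt_unique_of_im_pos hτ (fun t ht => theta4_two_mul_pow_four ht)
    ((hasDerivAt_comp_two_mul (hasDerivAt_theta4 h2)).pow 4)
    (((hasDerivAt_theta3 hτ).pow 2).mul ((hasDerivAt_theta4 hτ).pow 2))
  have h4 := theta4_two_mul_pow_four hτ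
  have hne : theta3 τ ^ 2 * theta4 τ ^ 2 ≠ 0 :=
    mul_ne_zero (pow_ne_zero _ (theta3_ne_zero hτ)) (pow_ne_zero _ (theta4_ne_zero hτ))
  apply mul_left_cancel₀ hne
  norm_num at h
  linear_combination h / 2 - 4 * logDeriv theta4 (2 * τ) * h4

lemma logDeriv_theta3_two_mul {τ : ℂ} (hτ : 0 < τ.im) :
    4 * (theta3 (2 * τ) ^ 2 * logDeriv theta3 (2 * τ)) =
      theta3 τ ^ 2 * logDeriv theta3 τ + theta4 τ ^ 2 * logDeriv theta4 τ := by
  have h2 := two_mul_im_pos hτ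
  have h := hasDerivAt_unique_of_im_pos hτ
    (f := fun t => 2 * theta3 (2 * t) ^ 2) (g := fun t => theta3 t ^ 2 + theta4 t ^ 2)
    (fun t ht => by rw [theta3_sq ht, theta4_sq ht]; ring)
    (((hasDerivAt_comp_two_mul (hasDerivAt_theta3 h2)).pow 2).const_mul 2)
    (((hasDerivAt_theta3 hτ).pow 2).add ((hasDerivAt_theta4 hτ).pow 2))
  norm_num at h
  linear_combination h / 2

/-- Derivatives of holomorphic functions with a limit at the cusp tend to zero there. -/
lemma tendsto_deriv_cusp {f : ℂ → ℂ} {c : ℂ} (hf : ∀ τ : ℂ, 0 < τ.im → DifferentiableAt ℂ f τ)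
    (h : Tendsto f (comap im atTop) (𝓝 c)) : Tendsto (deriv f) (comap im atTop) (𝓝 0) := by
  rw [Metric.tendsto_nhds] at h ⊢
  intro ε hε
  have h1 := h (ε / 2) (half_pos hε)
  rw [eventually_comap, eventually_atTop] at h1
  obtain ⟨M, hM⟩ := h1
  have h2 : ∀ᶠ τ : ℂ in comap im atTop, max M 0 + 1 < τ.im := tendsto_comap.eventually_gt_atTop _
  filter_upwards [h2] with τ hτ
  have him : ∀ z ∈ Metric.closedBall τ 1, max M 0 < z.im := by
    intro z hz
    have := (abs_im_le_norm (z - τ)).trans (mem_closedBall_iff_norm.mp hz)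
    rw [sub_im] at this
    linarith [(abs_le.mp this).1]
  have hd : DiffContOnCl ℂ (fun z => f z - c) (Metric.ball τ 1) := by
    refine DifferentiableOn.diffContOnCl fun z hz => ?_
    rw [closure_ball τ one_ne_zero] at hz
    exact ((hf z ((le_max_right _ _).trans_lt (him z hz))).sub_const c).differentiableWithinAt
  -- Cauchy's estimate on the unit disc about τ, which lies high in the half-plane.
  have := norm_deriv_le_of_forall_mem_sphere_norm_le one_pos hd (C := ε / 2) fun z hz => by
    have := hM z.im ((le_max_left _ _).trans (him z (Metric.sphere_subset_closedBall hz)).le) z rfl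
    rw [dist_eq_norm] at this
    exact this.le
  rw [deriv_sub_const] at this
  rw [dist_zero_right]
  linarith

lemma differentiableAt_logDeriv {f : ℂ → ℂ} (hf : ∀ τ : ℂ, 0 < τ.im → DifferentiableAt ℂ f τ)
    (h0 : ∀ τ : ℂ, 0 < τ.im → f τ ≠ 0) {τ : ℂ} (hτ : 0 < τ.im) :
    DifferentiableAt ℂ (logDeriv f) τ := by
  have h1 : DifferentiableOn ℂ f {τ : ℂ | 0 < τ.im} := fun t ht => (hf t ht).differentiableWithinAt
  have h2 := (h1.deriv isOpen_im_pos).differentiableAt (isOpen_im_pos.mem_nhds hτ)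
  exact h2.div (hf τ hτ) (h0 τ hτ)

lemma differentiableAt_logDeriv_theta3 {τ : ℂ} (hτ : 0 < τ.im) :
    DifferentiableAt ℂ (logDeriv theta3) τ :=
  differentiableAt_logDeriv (fun _ => differentiableAt_theta3) (fun _ => theta3_ne_zero) hτ

lemma differentiableAt_logDeriv_theta4 {τ : ℂ} (hτ : 0 < τ.im) :
    DifferentiableAt ℂ (logDeriv theta4) τ :=
  differentiableAt_logDeriv (fun _ => differentiableAt_theta4) (fun _ => theta4_ne_zero) hτ

lemma eventually_cusp_im_pos : ∀ᶠ τ : ℂ in comap im atTop, 0 < τ.im :=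
  tendsto_comap.eventually_gt_atTop 0

/-- If `(f - 1) / e^{πiτ} → c` at the cusp, then `f' / e^{πiτ} → πi c`. -/
lemma tendsto_deriv_div_exp {f : ℂ → ℂ} {c : ℂ}
    (hf : ∀ τ : ℂ, 0 < τ.im → DifferentiableAt ℂ f τ)
    (h : Tendsto (fun τ => (f τ - 1) / cexp (Real.pi * I * τ)) (comap im atTop) (𝓝 c)) :
    Tendsto (fun τ => deriv f τ / cexp (Real.pi * I * τ)) (comap im atTop)
      (𝓝 (Real.pi * I * c)) := by
  have hexp : ∀ τ : ℂ, HasDerivAt (fun t : ℂ => cexp (Real.pi * I * t))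
      (cexp (Real.pi * I * τ) * (Real.pi * I)) τ := fun τ => by
    simpa using ((hasDerivAt_id τ).const_mul (Real.pi * I : ℂ)).cexp
  have hd : ∀ τ : ℂ, 0 < τ.im →
      HasDerivAt (fun τ => (f τ - 1) / cexp (Real.pi * I * τ))
        ((deriv f τ * cexp (Real.pi * I * τ) - (f τ - 1) * (cexp (Real.pi * I * τ) *
          (Real.pi * I))) / cexp (Real.pi * I * τ) ^ 2) τ := fun τ hτ =>
    ((hf τ hτ).hasDerivAt.sub_const 1).div (hexp τ) (Complex.exp_ne_zero _)
  have h' := tendsto_deriv_cusp (fun τ hτ => (hd τ hτ).differentiableAt) h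
  have h2 := (h.const_mul (Real.pi * I : ℂ)).add h'
  rw [add_zero] at h2
  refine h2.congr' ?_
  filter_upwards [eventually_cusp_im_pos] with τ hτ
  rw [(hd τ hτ).deriv]
  have := Complex.exp_ne_zero (Real.pi * I * τ)
  field_simp
  ring

/-- The rigidity principle behind the differential identities: 2ⁿτ runs into the cusp while the
value stays fixed. -/
lemma eq_of_comp_two_mul_eq {F : ℂ → ℂ} {c : ℂ} (hF : ∀ τ : ℂ, 0 < τ.im → F (2 * τ) = F τ)
    (hc : Tendsto F (comap im atTop) (𝓝 c)) {τ : ℂ} (hτ : 0 < τ.im) : F τ = c := by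
  have h : ∀ n : ℕ, F ((2 : ℂ) ^ n * τ) = F τ := by
    intro n
    induction n with
    | zero => simp
    | succ n ih => rw [pow_succ', mul_assoc, hF _ (two_pow_mul_im_pos hτ n), ih]
  have hlim := hc.comp (tendsto_two_pow_mul_cusp hτ)
  have h1 : (F ∘ fun n : ℕ => (2 : ℂ) ^ n * τ) = fun _ => F τ := funext h
  rw [h1] at hlim
  exact tendsto_nhds_unique tendsto_const_nhds hlim

/-- The quotient of the left side by ϑ₂⁴ is invariant under doubling. The leading terms 2, −2 and 16
of ϑ₃ − 1, ϑ₄ − 1 and ϑ₂⁴ give its limit (2πi + 2πi)/16 at the cusp. -/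
lemma logDeriv_theta3_sub_theta4 {τ : ℂ} (hτ : 0 < τ.im) :
    logDeriv theta3 τ - logDeriv theta4 τ = Real.pi * I / 4 * theta2 τ ^ 4 := by
  let F : ℂ → ℂ := fun τ => (logDeriv theta3 τ - logDeriv theta4 τ) / theta2 τ ^ 4
  have hF : ∀ τ : ℂ, 0 < τ.im → F (2 * τ) = F τ := by
    intro τ hτ
    have h2 := two_mul_im_pos hτ
    have e4 := logDeriv_theta4_two_mul hτ
    have e3 := logDeriv_theta3_two_mul hτ
    have d2 := theta2_sq hτ
    have d3 := theta3_sq hτ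
    have d4 := theta4_sq hτ
    have n2 := theta2_ne_zero hτ
    have n22 := theta2_ne_zero h2
    have n23 := theta3_ne_zero h2
    simp only [F]
    rw [div_eq_div_iff (pow_ne_zero _ n22) (pow_ne_zero _ n2)]
    rw [show theta2 τ ^ 4 = (theta2 τ ^ 2) ^ 2 by ring, d2]
    rw [d3, d4] at e3
    linear_combination theta2 (2 * τ) ^ 2 * e3 -
      theta2 (2 * τ) ^ 2 * theta3 (2 * τ) ^ 2 * e4
  have hlim : Tendsto F (comap im atTop) (𝓝 (Real.pi * I / 4)) := by
    have a3 := (tendsto_deriv_div_exp (fun _ => differentiableAt_theta3)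
      tendsto_theta3_sub_one_div).div tendsto_theta3 one_ne_zero
    have a4 := (tendsto_deriv_div_exp (fun _ => differentiableAt_theta4)
      tendsto_theta4_sub_one_div).div tendsto_theta4 one_ne_zero
    have := (a3.sub a4).div tendsto_theta2_pow_four_div (by norm_num)
    rw [show ((Real.pi : ℂ) * I * 2 / 1 - Real.pi * I * -2 / 1) / 16 = Real.pi * I / 4 by ring]
      at this
    refine this.congr fun τ => ?_
    simp only [F, logDeriv_apply, Pi.div_apply]
    have := Complex.exp_ne_zero (Real.pi * I * τ)
    rw [div_right_comm, div_right_comm (deriv theta4 τ), ← sub_div,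
      div_div_div_cancel_right₀ this]
  have := eq_of_comp_two_mul_eq hF hlim hτ
  rwa [div_eq_iff (pow_ne_zero _ (theta2_ne_zero hτ))] at this

lemma hasDerivAt_neg_one_div {τ : ℂ} (hτ : 0 < τ.im) :
    HasDerivAt (fun t : ℂ => -1 / t) (1 / τ ^ 2) τ := by
  have hτ0 : τ ≠ 0 := by rintro rfl; simp at hτ
  refine ((hasDerivAt_inv hτ0).const_mul (-1)).congr_deriv ?_ |>.congr_of_eventuallyEq ?_
  · field_simp
  · exact Eventually.of_forall fun t => by simp [div_eq_mul_inv]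

/-- The image of the previous relation under τ ↦ −1/τ, which exchanges ϑ₂ and ϑ₄. Differentiating a
relation free of the square-root factor avoids its derivative. -/
lemma logDeriv_theta3_sub_theta2 {τ : ℂ} (hτ : 0 < τ.im) :
    logDeriv theta3 τ - logDeriv theta2 τ = -(Real.pi * I / 4 * theta4 τ ^ 4) := by
  have hτ0 : τ ≠ 0 := by rintro rfl; simp at hτ
  have hi := im_neg_one_div_pos hτ
  have e := logDeriv_theta3_sub_theta4 hi
  have h := hasDerivAt_unique_of_im_pos hτ
    (f := fun t => theta3 (-1 / t) * theta2 t) (g := fun t => theta4 (-1 / t) * theta3 t)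
    (fun t ht => by rw [theta3_inv ht, theta4_inv ht]; ring)
    (((hasDerivAt_theta3 hi).comp τ (hasDerivAt_neg_one_div hτ)).mul (hasDerivAt_theta2 hτ))
    (((hasDerivAt_theta4 hi).comp τ (hasDerivAt_neg_one_div hτ)).mul (hasDerivAt_theta3 hτ))
  simp only [Function.comp_apply] at h
  rw [theta3_inv hτ, theta4_inv hτ] at h
  rw [theta2_inv hτ, mul_pow, sqrt_factor_pow_four] at e
  have hne : (-I * τ) ^ (1 / 2 : ℂ) * theta3 τ * theta2 τ ≠ 0 :=
    mul_ne_zero (mul_ne_zero (sqrt_factor_ne_zero hτ) (theta3_ne_zero hτ)) (theta2_ne_zero hτ)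
  have h' : logDeriv theta3 τ - logDeriv theta2 τ =
      (logDeriv theta3 (-1 / τ) - logDeriv theta4 (-1 / τ)) / τ ^ 2 := by
    apply mul_left_cancel₀ hne
    linear_combination -h
  rw [h', e]
  field_simp

/-! ### The Riccati equation -/

/-- The defect of the Riccati equation satisfied by the logarithmic derivative of `ϑ₄`. -/
noncomputable def riccatiDefect (τ : ℂ) : ℂ :=
  deriv (logDeriv theta4) τ - 2 * logDeriv theta4 τ ^ 2 -
    (Real.pi : ℂ) ^ 2 / 8 * (theta2 τ ^ 4 * theta3 τ ^ 4)

/-- The Riccati equations for ϑ₃ and ϑ₄ have the same defect, because their difference already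
follows from the relations between logarithmic derivatives. -/
lemma riccatiDefect_eq {τ : ℂ} (hτ : 0 < τ.im) :
    riccatiDefect τ = deriv (logDeriv theta3) τ - 2 * logDeriv theta3 τ ^ 2 +
      (Real.pi : ℂ) ^ 2 / 8 * (theta2 τ ^ 4 * theta4 τ ^ 4) := by
  have h := hasDerivAt_unique_of_im_pos hτ (fun t ht => logDeriv_theta3_sub_theta4 ht)
    ((differentiableAt_logDeriv_theta3 hτ).hasDerivAt.sub
      (differentiableAt_logDeriv_theta4 hτ).hasDerivAt)
    (((hasDerivAt_theta2 hτ).pow 4).const_mul (Real.pi * I / 4 : ℂ))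
  norm_num at h
  have e1 := logDeriv_theta3_sub_theta4 hτ
  have e2 := logDeriv_theta3_sub_theta2 hτ
  have j := jacobi_identity hτ
  have e2' : logDeriv theta2 τ = logDeriv theta3 τ + Real.pi * I / 4 * theta4 τ ^ 4 := by
    linear_combination -e2
  have e1' : logDeriv theta4 τ = logDeriv theta3 τ - Real.pi * I / 4 * theta2 τ ^ 4 := by
    linear_combination -e1
  have h' : deriv (logDeriv theta4) τ = deriv (logDeriv theta3) τ -
      Real.pi * I * theta2 τ ^ 4 * logDeriv theta2 τ := by
    linear_combination -h
  rw [riccatiDefect, h', e2', e1', j]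
  linear_combination (-(Real.pi : ℂ) ^ 2 / 4 * theta2 τ ^ 4 * theta4 τ ^ 4
    - (Real.pi : ℂ) ^ 2 / 8 * theta2 τ ^ 8) * I_sq

/-- Duplication makes 4(ϑ₄'/ϑ₄)(2τ) the sum of the logarithmic derivatives of ϑ₃ and ϑ₄ at τ, so the
two expressions for the defect are added. -/
lemma riccatiDefect_two_mul {τ : ℂ} (hτ : 0 < τ.im) :
    4 * riccatiDefect (2 * τ) = riccatiDefect τ := by
  have h2 := two_mul_im_pos hτ
  have h := hasDerivAt_unique_of_im_pos hτ (fun t ht => logDeriv_theta4_two_mul ht)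
    ((hasDerivAt_comp_two_mul (differentiableAt_logDeriv_theta4 h2).hasDerivAt).const_mul 4)
    ((differentiableAt_logDeriv_theta3 hτ).hasDerivAt.add
      (differentiableAt_logDeriv_theta4 hτ).hasDerivAt)
  have e := riccatiDefect_eq hτ
  have e4 := logDeriv_theta4_two_mul hτ
  have e1 := logDeriv_theta3_sub_theta4 hτ
  have d2 := theta2_sq hτ
  have j := jacobi_identity hτ
  have e4' : logDeriv theta4 (2 * τ) = (logDeriv theta3 τ + logDeriv theta4 τ) / 4 := by
    linear_combination e4 / 4
  have e1' : logDeriv theta4 τ = logDeriv theta3 τ - Real.pi * I / 4 * theta2 τ ^ 4 := by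
    linear_combination -e1
  have d2' : theta2 (2 * τ) ^ 4 * theta3 (2 * τ) ^ 4 = theta2 τ ^ 8 / 16 := by
    rw [show theta2 τ ^ 8 = (theta2 τ ^ 2) ^ 4 by ring, d2]; ring
  have e' : 2 * riccatiDefect τ = (deriv (logDeriv theta3) τ - 2 * logDeriv theta3 τ ^ 2 +
      (Real.pi : ℂ) ^ 2 / 8 * (theta2 τ ^ 4 * theta4 τ ^ 4)) + (deriv (logDeriv theta4) τ -
      2 * logDeriv theta4 τ ^ 2 - (Real.pi : ℂ) ^ 2 / 8 * (theta2 τ ^ 4 * theta3 τ ^ 4)) := by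
    rw [two_mul, e, ← e]; rfl
  have goal2 : 8 * riccatiDefect (2 * τ) = 2 * riccatiDefect τ := by
    rw [e', riccatiDefect, d2', e4', e1', j]
    linear_combination h + ((Real.pi : ℂ) ^ 2 / 16 * theta2 τ ^ 8) * I_sq
  linear_combination goal2 / 2

lemma theta4_add_two (τ : ℂ) : theta4 (τ + 2) = theta4 τ := by
  rw [theta4_eq, theta4_eq, jacobiTheta₂_add_right]

lemma logDeriv_comp_add_const {f : ℂ → ℂ} {c : ℂ} (hf : ∀ τ, f (τ + c) = f τ) (τ : ℂ) :
    logDeriv f (τ + c) = logDeriv f τ := by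
  rw [logDeriv_apply, logDeriv_apply, hf, ← deriv_comp_add_const, funext hf]

lemma riccatiDefect_periodic : Function.Periodic riccatiDefect (2 : ℝ) := by
  intro τ
  have h := logDeriv_comp_add_const theta4_add_two
  have hd : deriv (logDeriv theta4) (τ + 2) = deriv (logDeriv theta4) τ := by
    rw [← deriv_comp_add_const, funext h]
  have h2 : theta2 (τ + 2) ^ 4 = theta2 τ ^ 4 := by
    rw [show τ + 2 = τ + 1 + 1 by ring, theta2_add_one_pow_four, theta2_add_one_pow_four, neg_neg]
  simp only [riccatiDefect, ofReal_ofNat]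
  rw [h, hd, h2, theta3_add_two]

lemma tendsto_logDeriv_theta4 : Tendsto (logDeriv theta4) (comap im atTop) (𝓝 0) := by
  have := (tendsto_deriv_cusp (fun _ => differentiableAt_theta4) tendsto_theta4).div
    tendsto_theta4 one_ne_zero
  rwa [zero_div] at this

lemma tendsto_riccatiDefect : Tendsto riccatiDefect (comap im atTop) (𝓝 0) := by
  have h := ((tendsto_deriv_cusp (fun _ => differentiableAt_logDeriv_theta4)
    tendsto_logDeriv_theta4).sub ((tendsto_logDeriv_theta4.pow 2).const_mul 2)).sub
    ((tendsto_theta2_pow_four.mul (tendsto_theta3.pow 4)).const_mul ((Real.pi : ℂ) ^ 2 / 8))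
  simp only [zero_mul, mul_zero, sub_zero, ne_eq, OfNat.ofNat_ne_zero, not_false_eq_true,
    zero_pow] at h
  exact h

lemma differentiableAt_riccatiDefect {τ : ℂ} (hτ : 0 < τ.im) :
    DifferentiableAt ℂ riccatiDefect τ := by
  have h1 : DifferentiableOn ℂ (logDeriv theta4) {τ : ℂ | 0 < τ.im} := fun t ht =>
    (differentiableAt_logDeriv_theta4 ht).differentiableWithinAt
  have h2 := (h1.deriv isOpen_im_pos).differentiableAt (isOpen_im_pos.mem_nhds hτ)
  exact (h2.sub (((differentiableAt_logDeriv_theta4 hτ).pow 2).const_mul 2)).sub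
    ((((differentiableAt_theta2 hτ).pow 4).mul ((differentiableAt_theta3 hτ).pow 4)).const_mul _)

/-- The product (Im τ)²·defect is invariant under doubling. Periodicity upgrades convergence of the
defect to exponential decay, which beats (Im τ)², so the invariant product is zero. -/
lemma riccatiDefect_eq_zero {τ : ℂ} (hτ : 0 < τ.im) : riccatiDefect τ = 0 := by
  have hdecay := Function.Periodic.exp_decay_of_zero_at_inf two_pos riccatiDefect_periodic
    (eventually_cusp_im_pos.mono fun _ h => differentiableAt_riccatiDefect h) tendsto_riccatiDefect
  have hscaled : Tendsto (fun τ : ℂ => (τ.im : ℂ) ^ 2 * riccatiDefect τ) (comap im atTop)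
      (𝓝 0) := by
    have hsq : (fun τ : ℂ => (τ.im : ℂ) ^ 2) =O[comap im atTop] fun τ : ℂ => τ.im ^ 2 :=
      Asymptotics.isBigO_of_le _ fun τ => by simp
    refine (hsq.mul hdecay).trans_tendsto ?_
    have h1 : Tendsto (fun x : ℝ => x ^ 2 * Real.exp (-Real.pi * x)) atTop (𝓝 0) := by
      have := Real.tendsto_pow_mul_exp_neg_atTop_nhds_zero 2
      refine squeeze_zero' (Eventually.of_forall fun x => by positivity) ?_ this
      filter_upwards [eventually_ge_atTop 0] with x hx
      gcongr
      nlinarith [Real.pi_gt_three]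
    refine (h1.comp (tendsto_comap (f := im))).congr fun τ => ?_
    simp only [Function.comp_apply]
    congr 2
    ring
  have hF : ∀ τ : ℂ, 0 < τ.im → ((2 * τ).im : ℂ) ^ 2 * riccatiDefect (2 * τ) =
      (τ.im : ℂ) ^ 2 * riccatiDefect τ := by
    intro τ hτ
    have : ((2 * τ).im : ℂ) = 2 * τ.im := by simp
    rw [this]
    linear_combination (τ.im : ℂ) ^ 2 * riccatiDefect_two_mul hτ
  have := eq_of_comp_two_mul_eq hF hscaled hτ
  have him : (τ.im : ℂ) ≠ 0 := by exact_mod_cast hτ.ne'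
  exact (mul_eq_zero.mp this).resolve_left (pow_ne_zero _ him)

/-- The Riccati equation for the logarithmic derivative of `ϑ₃`. -/
lemma deriv_logDeriv_theta3 {τ : ℂ} (hτ : 0 < τ.im) :
    deriv (logDeriv theta3) τ = 2 * logDeriv theta3 τ ^ 2 -
      (Real.pi : ℂ) ^ 2 / 8 * (theta2 τ ^ 4 * theta4 τ ^ 4) := by
  have h := riccatiDefect_eq hτ
  rw [riccatiDefect_eq_zero hτ] at h
  linear_combination -h

/-! ### The discriminant, E₂ and the Weierstrass eta-function -/

/-- The function `(ϑ₂ϑ₃ϑ₄)⁸`, a multiple of the modular discriminant. -/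
noncomputable def thetaProd (τ : ℂ) : ℂ := (theta2 τ * theta3 τ * theta4 τ) ^ 8

lemma thetaProd_add_one (τ : ℂ) : thetaProd (τ + 1) = thetaProd τ := by
  have h2 := theta2_add_one_pow_four τ
  simp only [thetaProd, theta3_add_one, theta4_add_one, mul_pow]
  rw [show theta2 (τ + 1) ^ 8 = (theta2 (τ + 1) ^ 4) ^ 2 by ring, h2]
  ring

lemma thetaProd_inv {τ : ℂ} (hτ : 0 < τ.im) : thetaProd (-1 / τ) = τ ^ 12 * thetaProd τ := by
  simp only [thetaProd, theta2_inv hτ, theta3_inv hτ, theta4_inv hτ]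
  have h := sqrt_factor_pow_four τ
  generalize (-I * τ) ^ (1 / 2 : ℂ) = s at h
  have : s ^ 24 = τ ^ 12 := by rw [show s ^ 24 = (s ^ 4) ^ 6 by ring, h]; ring
  rw [← this]
  ring

lemma thetaProd_ne_zero {τ : ℂ} (hτ : 0 < τ.im) : thetaProd τ ≠ 0 :=
  pow_ne_zero _ (mul_ne_zero (mul_ne_zero (theta2_ne_zero hτ) (theta3_ne_zero hτ))
    (theta4_ne_zero hτ))

lemma differentiableAt_thetaProd {τ : ℂ} (hτ : 0 < τ.im) : DifferentiableAt ℂ thetaProd τ :=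
  (((differentiableAt_theta2 hτ).mul (differentiableAt_theta3 hτ)).mul
    (differentiableAt_theta4 hτ)).pow 8

lemma tendsto_thetaProd : Tendsto thetaProd (comap im atTop) (𝓝 0) := by
  have h := ((tendsto_theta2_pow_four.pow 2).mul (tendsto_theta3.pow 8)).mul
    (tendsto_theta4.pow 8)
  norm_num at h
  exact h.congr fun τ => by rw [thetaProd]; ring

section ModularForm

open UpperHalfPlane hiding I
open ModularForm MatrixGroups SlashInvariantForm EisensteinSeries

lemma thetaProd_slash_T :
    (fun z : ℍ => thetaProd z) ∣[(12 : ℤ)] ModularGroup.T = fun z : ℍ => thetaProd z := by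
  ext z
  rw [slash_action_eq'_iff, modular_T_smul]
  have h : ((1 : ℝ) +ᵥ z : ℍ) = (z : ℂ) + 1 := by
    rw [UpperHalfPlane.coe_vadd, ofReal_one, add_comm]
  simp only [h, thetaProd_add_one, ModularGroup.T]
  simp

lemma thetaProd_slash_S :
    (fun z : ℍ => thetaProd z) ∣[(12 : ℤ)] ModularGroup.S = fun z : ℍ => thetaProd z := by
  ext z
  have h := thetaProd_inv z.2
  rw [slash_action_eq'_iff, modular_S_smul]
  have h1 : ((UpperHalfPlane.mk (-(z : ℂ))⁻¹ z.im_inv_neg_coe_pos : ℍ) : ℂ) = -1 / (z : ℂ) := by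
    change (-(z : ℂ))⁻¹ = _
    rw [inv_neg, neg_div, one_div]
  have h2 : ((ModularGroup.S 1 0 : ℤ) : ℂ) * z + ((ModularGroup.S 1 1 : ℤ) : ℂ) = z := by
    simp [ModularGroup.S]
  rw [h2, h1, zpow_ofNat]
  exact h

/-- `(ϑ₂ϑ₃ϑ₄)⁸` as a cusp form of weight 12 and level 1. -/
noncomputable def thetaProdCuspForm : CuspForm 𝒮ℒ 12 where
  toFun := fun z : ℍ => thetaProd z
  slash_action_eq' A hA := by
    obtain ⟨A, rfl⟩ := hA
    exact slash_action_generators_SL2Z thetaProd_slash_S thetaProd_slash_T A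
  holo' := by
    rw [UpperHalfPlane.mdifferentiable_iff]
    refine .congr (fun z hz ↦ (differentiableAt_thetaProd hz).differentiableWithinAt) fun z hz ↦ ?_
    simp [ofComplex_apply_of_im_pos hz]
  zero_at_cusps' hc := by
    rw [Subgroup.IsArithmetic.isCusp_iff_isCusp_SL2Z] at hc
    rw [OnePoint.isZeroAt_iff_forall_SL2Z hc]
    intro γ _
    rw [slash_action_generators_SL2Z thetaProd_slash_S thetaProd_slash_T]
    exact tendsto_thetaProd.comp tendsto_coe_atImInfty

/-- Dividing by the discriminant produces the weight 12 − 12; keeping the weight as a variable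
allows it to be replaced by 0. -/
lemma exists_eq_const_of_weight_eq_zero {k : ℤ} (hk : k = 0) (f : ModularForm 𝒮ℒ k) :
    ∃ c, ∀ z, f z = c := by
  subst hk
  obtain ⟨c, hc⟩ := ModularFormClass.levelOne_weight_zero_const f
  exact ⟨c, congrFun hc⟩

lemma exists_thetaProd_eq :
    ∃ c : ℂ, ∀ τ : ℂ, 0 < τ.im → thetaProd τ = c * ModularForm.eta τ ^ 24 := by
  obtain ⟨c, hc⟩ := exists_eq_const_of_weight_eq_zero (by norm_num)
    (CuspForm.discriminantEquiv thetaProdCuspForm)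
  refine ⟨c, fun τ hτ => ?_⟩
  have h1 := discriminant_mul_discriminantEquiv_apply thetaProdCuspForm ⟨τ, hτ⟩
  rw [hc, mul_comm] at h1
  exact h1.symm

/-- Logarithmic differentiation of (ϑ₂ϑ₃ϑ₄)⁸ = c·η²⁴, η here being Dedekind's; the unknown c
disappears once it is nonzero. -/
lemma logDeriv_theta_add {τ : ℂ} (hτ : 0 < τ.im) :
    logDeriv theta2 τ + logDeriv theta3 τ + logDeriv theta4 τ =
      Real.pi * I / 4 * E2 ⟨τ, hτ⟩ := by
  obtain ⟨c, hc⟩ := exists_thetaProd_eq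
  have hc0 : c ≠ 0 := by
    rintro rfl
    exact thetaProd_ne_zero hτ (by rw [hc τ hτ, zero_mul])
  have h1 := logDeriv_eta_eq_E2 ⟨τ, hτ⟩
  have hη : DifferentiableAt ℂ ModularForm.eta τ := differentiableAt_eta_of_mem_upperHalfPlaneSet hτ
  have h2 : logDeriv thetaProd τ = logDeriv (fun t => c * ModularForm.eta t ^ 24) τ :=
    (logDeriv_congr_nhds ((eventually_im_pos hτ).mono hc)).self_of_nhds
  rw [logDeriv_const_mul _ _ hc0, logDeriv_fun_pow hη] at h2
  have d2 := differentiableAt_theta2 hτ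
  have d3 := differentiableAt_theta3 hτ
  have d4 := differentiableAt_theta4 hτ
  have n2 := theta2_ne_zero hτ
  have n3 := theta3_ne_zero hτ
  have h3 : logDeriv thetaProd τ =
      8 * (logDeriv theta2 τ + logDeriv theta3 τ + logDeriv theta4 τ) := by
    unfold thetaProd
    rw [logDeriv_fun_pow (f := fun t => theta2 t * theta3 t * theta4 t)
        ((d2.fun_mul d3).fun_mul d4), logDeriv_mul (f := fun t => theta2 t * theta3 t) _ (mul_ne_zero n2 n3)
      (theta4_ne_zero hτ) (d2.fun_mul d3) d4, logDeriv_mul _ n2 n3 d2 d3]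
    norm_num
  rw [h3] at h2
  change logDeriv ModularForm.eta τ = _ at h1
  rw [h1] at h2
  push_cast at h2
  linear_combination h2 / 8

/-- The derivative of the geometric series rearranges into the divisor sum of `E₂`. -/
lemma tsum_div_one_sub_sq {q : ℂ} (hq : ‖q‖ < 1) :
    ∑' k : ℕ+, q ^ (k : ℕ) / (1 - q ^ (k : ℕ)) ^ 2 =
      ∑' n : ℕ+, (ArithmeticFunction.sigma 1 n : ℂ) * q ^ (n : ℕ) := by
  rw [← tsum_prod_pow_eq_tsum_sigma 1 hq]
  refine tsum_congr fun d => ?_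
  have hd : ‖q ^ (d : ℕ)‖ < 1 := by
    rw [norm_pow]; exact pow_lt_one₀ (norm_nonneg _) hq d.ne_zero
  have hs : Summable fun n : ℕ => (n : ℂ) * (q ^ (d : ℕ)) ^ n := by
    simpa using summable_pow_mul_geometric_of_norm_lt_one 1 hd
  rw [← tsum_coe_mul_geometric_of_norm_lt_one hd, ← tsum_zero_pnat_eq_tsum_nat hs]
  simp [pow_mul]

lemma weierstrassEta_eq {τ : ℂ} (hτ : 0 < τ.im) :
    weierstrassEta τ = (Real.pi : ℂ) ^ 2 / 12 * E2 ⟨τ, hτ⟩ := by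
  have hq := norm_exp_two_pi_I_lt_one ⟨τ, hτ⟩
  have hterm : ∀ k : ℕ+, cexp (2 * k * (Real.pi * I * τ)) = cexp (2 * Real.pi * I * τ) ^ (k : ℕ) := by
    intro k
    rw [← Complex.exp_nat_mul]
    congr 1; ring
  have h := E2_eq_tsum_cexp ⟨τ, hτ⟩
  rw [← tsum_div_one_sub_sq hq] at h
  rw [h, weierstrassEta]
  simp_rw [hterm]
  ring

end ModularForm

/-- The logarithmic derivative of `ϑ₃` in terms of the Weierstrass eta-function. -/
lemma logDeriv_theta3_eq {τ : ℂ} (hτ : 0 < τ.im) :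
    logDeriv theta3 τ = I / Real.pi *
      ((Real.pi : ℂ) ^ 2 / 12 * (theta2 τ ^ 4 - theta4 τ ^ 4) + weierstrassEta τ) := by
  have h := logDeriv_theta_add hτ
  have h4 := logDeriv_theta3_sub_theta4 hτ
  have h2 := logDeriv_theta3_sub_theta2 hτ
  have hπ : (Real.pi : ℂ) ≠ 0 := by exact_mod_cast Real.pi_ne_zero
  rw [weierstrassEta_eq hτ]
  have : 3 * logDeriv theta3 τ = Real.pi * I / 4 *
    EisensteinSeries.E2 ⟨τ, hτ⟩ +
      Real.pi * I / 4 * (theta2 τ ^ 4 - theta4 τ ^ 4) := by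
    linear_combination h + h4 + h2
  field_simp
  linear_combination 4 * this

/-! ### The theta formulas solve the system -/

lemma hasDerivAt_linear (γ δ h : ℂ) : HasDerivAt (fun h => γ * h + δ) γ h := by
  simpa using ((hasDerivAt_id h).const_mul γ).add_const δ

lemma hasDerivAt_mobius {α β γ δ h : ℂ} (hdet : α * δ - β * γ = 1) (hs : γ * h + δ ≠ 0) :
    HasDerivAt (mobius α β γ δ) (1 / (γ * h + δ) ^ 2) h := by
  refine ((hasDerivAt_linear α β h).div (hasDerivAt_linear γ δ h) hs).congr_deriv ?_
  congr 1
  linear_combination hdet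

lemma isOpen_timeDomain (α β γ δ : ℂ) : IsOpen (timeDomain α β γ δ) := by
  rw [isOpen_iff_mem_nhds]
  rintro h ⟨hs, him⟩
  have h1 : ∀ᶠ t in 𝓝 h, γ * t + δ ≠ 0 :=
    (hasDerivAt_linear γ δ h).continuousAt.eventually_ne hs
  have h2 : ContinuousAt (mobius α β γ δ) h :=
    (hasDerivAt_linear α β h).continuousAt.div (hasDerivAt_linear γ δ h).continuousAt hs
  have h3 : ∀ᶠ t in 𝓝 h, 0 < (mobius α β γ δ t).im :=
    (continuous_im.continuousAt.comp h2).eventually (lt_mem_nhds him)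
  exact h1.and h3

lemma timeDomain_nonempty {α β γ δ : ℂ} (hdet : α * δ - β * γ = 1) :
    (timeDomain α β γ δ).Nonempty := by
  have key : ∀ τ : ℂ, 0 < τ.im → α - γ * τ ≠ 0 → (timeDomain α β γ δ).Nonempty := by
    intro τ hτ hne
    refine ⟨(δ * τ - β) / (α - γ * τ), ?_, ?_⟩
    · rw [show γ * ((δ * τ - β) / (α - γ * τ)) + δ = 1 / (α - γ * τ) by
        field_simp; linear_combination hdet]
      exact one_div_ne_zero hne
    · rw [mobius, show γ * ((δ * τ - β) / (α - γ * τ)) + δ = 1 / (α - γ * τ) by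
        field_simp; linear_combination hdet,
        show α * ((δ * τ - β) / (α - γ * τ)) + β = τ / (α - γ * τ) by
        rw [mul_div_assoc', div_add' _ _ _ hne]; congr 1; linear_combination τ * hdet, div_div_div_cancel_right₀ hne, div_one]
      exact hτ
  -- If α − γτ vanished at both i and 2i, then α = γ = 0, against the determinant condition.
  by_cases h1 : α - γ * I = 0
  · refine key (2 * I) (by simp) fun h2 => ?_
    have hγ : γ = 0 := by
      have : γ * I = 0 := by linear_combination h1 - h2
      exact (mul_eq_zero.mp this).resolve_right I_ne_zero
    have hα : α = 0 := by rw [hγ] at h1; simpa using h1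
    rw [hγ, hα] at hdet
    simp at hdet
  · exact key I (by simp) h1

lemma IsRootPair.ne_zero {c ρ σ : ℂ} (h : IsRootPair c ρ σ) : ρ ≠ 0 := by
  rintro rfl
  have := h.2.2
  rw [zero_mul] at this
  exact div_ne_zero I_ne_zero (by exact_mod_cast Real.pi_ne_zero) this.symm

lemma IsRootPair.sigma_eq {c ρ σ : ℂ} (h : IsRootPair c ρ σ) : σ = I / Real.pi / ρ := by
  rw [eq_div_iff h.ne_zero, mul_comm, h.2.2]

/-- Eliminates η in favour of the logarithmic derivative of ϑ₃, so that differentiating `B` needs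
only the Riccati equation. -/
lemma solB_eq {c α β γ δ ρ σ h : ℂ} (hroot : IsRootPair c ρ σ) (hh : h ∈ timeDomain α β γ δ) :
    solB σ α β γ δ h = 1 / (2 * ρ) * ((2 * logDeriv theta3 (mobius α β γ δ h) / (γ * h + δ) - γ) /
      theta3 (mobius α β γ δ h) ^ 2) := by
  obtain ⟨hs, him⟩ := hh
  have h3 := theta3_ne_zero him
  have hρ := hroot.ne_zero
  have hπ : (Real.pi : ℂ) ≠ 0 := by exact_mod_cast Real.pi_ne_zero
  rw [solB, hroot.sigma_eq, logDeriv_theta3_eq him]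
  field_simp
  linear_combination 12 * γ * (γ * h + δ) * Real.pi * I_sq

section Derivatives

variable {α β γ δ h : ℂ}

lemma hasDerivAt_theta2_mobius (hdet : α * δ - β * γ = 1) (hh : h ∈ timeDomain α β γ δ) :
    HasDerivAt (fun h => theta2 (mobius α β γ δ h)) (logDeriv theta2 (mobius α β γ δ h) *
      theta2 (mobius α β γ δ h) * (1 / (γ * h + δ) ^ 2)) h :=
  (hasDerivAt_theta2 hh.2).comp h (hasDerivAt_mobius hdet hh.1)

lemma hasDerivAt_theta3_mobius (hdet : α * δ - β * γ = 1) (hh : h ∈ timeDomain α β γ δ) :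
    HasDerivAt (fun h => theta3 (mobius α β γ δ h)) (logDeriv theta3 (mobius α β γ δ h) *
      theta3 (mobius α β γ δ h) * (1 / (γ * h + δ) ^ 2)) h :=
  (hasDerivAt_theta3 hh.2).comp h (hasDerivAt_mobius hdet hh.1)

lemma hasDerivAt_theta4_mobius (hdet : α * δ - β * γ = 1) (hh : h ∈ timeDomain α β γ δ) :
    HasDerivAt (fun h => theta4 (mobius α β γ δ h)) (logDeriv theta4 (mobius α β γ δ h) *
      theta4 (mobius α β γ δ h) * (1 / (γ * h + δ) ^ 2)) h :=
  (hasDerivAt_theta4 hh.2).comp h (hasDerivAt_mobius hdet hh.1)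

lemma hasDerivAt_solA {c ρ σ : ℂ} (hdet : α * δ - β * γ = 1) (hroot : IsRootPair c ρ σ)
    (hh : h ∈ timeDomain α β γ δ) :
    HasDerivAt (solA ρ α β γ δ) (2 * solA ρ α β γ δ h ^ 2 * solB σ α β γ δ h) h := by
  have hd := (((hasDerivAt_theta3_mobius hdet hh).fun_pow 2).fun_div (hasDerivAt_linear γ δ h)
    hh.1).const_mul ρ
  refine hd.congr_deriv ?_
  have h3 := theta3_ne_zero hh.2
  have hs := hh.1
  have hρ := hroot.ne_zero
  rw [solB_eq hroot hh, solA]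
  generalize theta3 (mobius α β γ δ h) = t at *
  generalize logDeriv theta3 (mobius α β γ δ h) = l at *
  norm_num
  field_simp

lemma hasDerivAt_solB {c ρ σ : ℂ} (hc : c ≠ 0) (hdet : α * δ - β * γ = 1)
    (hroot : IsRootPair c ρ σ) (hh : h ∈ timeDomain α β γ δ) :
    HasDerivAt (solB σ α β γ δ) (solb c α β γ δ h * solA ρ α β γ δ h ^ 3) h := by
  have h3 := theta3_ne_zero hh.2
  have hs := hh.1
  have hρ := hroot.ne_zero
  have hl : HasDerivAt (fun h => logDeriv theta3 (mobius α β γ δ h))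
      (deriv (logDeriv theta3) (mobius α β γ δ h) * (1 / (γ * h + δ) ^ 2)) h :=
    (differentiableAt_logDeriv_theta3 hh.2).hasDerivAt.comp h (hasDerivAt_mobius hdet hh.1)
  have hd := ((((hl.const_mul 2).fun_div (hasDerivAt_linear γ δ h) hs).sub_const γ).fun_div
    ((hasDerivAt_theta3_mobius hdet hh).fun_pow 2) (pow_ne_zero 2 h3)).const_mul (1 / (2 * ρ))
  refine (hd.congr_of_eventuallyEq ?_).congr_deriv ?_
  · filter_upwards [(isOpen_timeDomain α β γ δ).mem_nhds hh] with t ht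
    exact solB_eq hroot ht
  · have hρ4 : ρ ^ 4 * c ^ 2 = -(Real.pi : ℂ) ^ 2 := by
      rw [show ρ ^ 4 = (ρ ^ 2) ^ 2 by ring, hroot.1]
      field_simp
      linear_combination I_sq
    rw [deriv_logDeriv_theta3 hh.2, solb, solA]
    generalize theta3 (mobius α β γ δ h) = t at *
    generalize theta2 (mobius α β γ δ h) = u at *
    generalize theta4 (mobius α β γ δ h) = v at *
    generalize logDeriv theta3 (mobius α β γ δ h) = l at *
    norm_num
    field_simp
    linear_combination (-u ^ 4 * v ^ 4) * hρ4

lemma hasDerivAt_sola {c ρ σ : ℂ} (hc : c ≠ 0) (hdet : α * δ - β * γ = 1)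
    (hroot : IsRootPair c ρ σ) (hh : h ∈ timeDomain α β γ δ) :
    HasDerivAt (sola c α β γ δ) (-16 * solb c α β γ δ h * solA ρ α β γ δ h ^ 2) h := by
  have h3 := theta3_ne_zero hh.2
  have hs := hh.1
  have hd := ((((hasDerivAt_theta2_mobius hdet hh).fun_pow 4).fun_div
    ((hasDerivAt_theta3_mobius hdet hh).fun_pow 4) (pow_ne_zero 4 h3)).const_mul (2 * c)).const_sub c
  refine hd.congr_deriv ?_
  have e := logDeriv_theta3_sub_theta2 hh.2
  have hρ := hroot.1
  rw [solb, solA, mul_pow, hρ]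
  generalize theta3 (mobius α β γ δ h) = t at *
  generalize theta2 (mobius α β γ δ h) = u at *
  generalize theta4 (mobius α β γ δ h) = v at *
  generalize logDeriv theta3 (mobius α β γ δ h) = l at *
  generalize logDeriv theta2 (mobius α β γ δ h) = m at *
  norm_num
  field_simp
  linear_combination (-64 * u ^ 4) * e

lemma hasDerivAt_solb {c ρ σ : ℂ} (hc : c ≠ 0) (hdet : α * δ - β * γ = 1)
    (hroot : IsRootPair c ρ σ) (hh : h ∈ timeDomain α β γ δ) :
    HasDerivAt (solb c α β γ δ)
      (sola c α β γ δ h * solb c α β γ δ h * solA ρ α β γ δ h ^ 2) h := by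
  have h3 := theta3_ne_zero hh.2
  have hs := hh.1
  have hd := ((((hasDerivAt_theta2_mobius hdet hh).fun_pow 4).fun_mul
    ((hasDerivAt_theta4_mobius hdet hh).fun_pow 4)).fun_div
    ((hasDerivAt_theta3_mobius hdet hh).fun_pow 8) (pow_ne_zero 8 h3)).const_mul (c ^ 2 / 8)
  refine hd.congr_deriv ?_
  have e := logDeriv_theta3_sub_theta2 hh.2
  have e' := logDeriv_theta3_sub_theta4 hh.2
  have j := jacobi_identity hh.2
  have hρ := hroot.1
  rw [sola, solb, solA, mul_pow, hρ]
  generalize theta3 (mobius α β γ δ h) = t at *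
  generalize theta2 (mobius α β γ δ h) = u at *
  generalize theta4 (mobius α β γ δ h) = v at *
  generalize logDeriv theta3 (mobius α β γ δ h) = l at *
  generalize logDeriv theta2 (mobius α β γ δ h) = m at *
  generalize logDeriv theta4 (mobius α β γ δ h) = n at *
  norm_num
  field_simp
  linear_combination (u ^ 4 * v ^ 4) * (-4 * e - 4 * e' - Real.pi * I * j)

lemma sola_sq_add {c : ℂ} (hh : h ∈ timeDomain α β γ δ) :
    c ^ 2 = sola c α β γ δ h ^ 2 + 32 * solb c α β γ δ h := by
  have h3 := theta3_ne_zero hh.2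
  have j := jacobi_identity hh.2
  rw [sola, solb]
  field_simp
  linear_combination (32 * c ^ 2 * theta2 (mobius α β γ δ h) ^ 4) * j

lemma solA_ne_zero {ρ : ℂ} (hρ : ρ ≠ 0) (hh : h ∈ timeDomain α β γ δ) :
    solA ρ α β γ δ h ≠ 0 :=
  mul_ne_zero hρ (div_ne_zero (pow_ne_zero _ (theta3_ne_zero hh.2)) hh.1)

lemma solb_ne_zero {c : ℂ} (hc : c ≠ 0) (hh : h ∈ timeDomain α β γ δ) :
    solb c α β γ δ h ≠ 0 :=
  mul_ne_zero (div_ne_zero (pow_ne_zero _ hc) (by norm_num))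
    (div_ne_zero (mul_ne_zero (pow_ne_zero _ (theta2_ne_zero hh.2))
      (pow_ne_zero _ (theta4_ne_zero hh.2))) (pow_ne_zero _ (theta3_ne_zero hh.2)))

end Derivatives

lemma isSolutionOn_timeDomain {c α β γ δ ρ σ : ℂ} (hc : c ≠ 0) (hdet : α * δ - β * γ = 1)
    (hroot : IsRootPair c ρ σ) :
    IsSolutionOn (timeDomain α β γ δ) (solA ρ α β γ δ) (solB σ α β γ δ)
      (sola c α β γ δ) (solb c α β γ δ) := fun _ hh =>
  ⟨hasDerivAt_solA hdet hroot hh, hasDerivAt_solB hc hdet hroot hh,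
    hasDerivAt_sola hc hdet hroot hh, hasDerivAt_solb hc hdet hroot hh⟩

/-! ### Klein's invariant and reduction theory -/

/-- A multiple of Klein's invariant, expressed by theta constants. -/
noncomputable def thetaInvariant (τ : ℂ) : ℂ :=
  (theta2 τ ^ 8 + theta3 τ ^ 8 + theta4 τ ^ 8) ^ 3 / thetaProd τ

lemma thetaInvariant_add_one (τ : ℂ) : thetaInvariant (τ + 1) = thetaInvariant τ := by
  rw [thetaInvariant, thetaInvariant, thetaProd_add_one, theta3_add_one, theta4_add_one,
    show theta2 (τ + 1) ^ 8 = (theta2 (τ + 1) ^ 4) ^ 2 by ring, theta2_add_one_pow_four]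
  ring

lemma thetaInvariant_inv {τ : ℂ} (hτ : 0 < τ.im) : thetaInvariant (-1 / τ) = thetaInvariant τ := by
  have hτ0 : τ ≠ 0 := by rintro rfl; simp at hτ
  rw [thetaInvariant, thetaInvariant, thetaProd_inv hτ, theta2_inv hτ, theta3_inv hτ, theta4_inv hτ]
  have h := sqrt_factor_pow_four τ
  generalize (-I * τ) ^ (1 / 2 : ℂ) = s at h
  have h8 : s ^ 8 = τ ^ 4 := by rw [show s ^ 8 = (s ^ 4) ^ 2 by ring, h]; ring
  have := thetaProd_ne_zero hτ
  simp only [mul_pow, h8]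
  field_simp
  ring

lemma tendsto_norm_thetaInvariant :
    Tendsto (fun τ => ‖thetaInvariant τ‖) (comap im atTop) atTop := by
  have hnum : Tendsto (fun τ => ‖(theta2 τ ^ 8 + theta3 τ ^ 8 + theta4 τ ^ 8) ^ 3‖) (comap im atTop)
      (𝓝 8) := by
    have h := ((((tendsto_theta2_pow_four.pow 2).add (tendsto_theta3.pow 8)).add
      (tendsto_theta4.pow 8)).pow 3).norm
    norm_num at h
    simpa only [norm_pow, ← pow_mul] using h
  have hden : Tendsto (fun τ => ‖thetaProd τ‖⁻¹) (comap im atTop) atTop := by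
    refine tendsto_inv_nhdsGT_zero.comp (tendsto_nhdsWithin_iff.mpr ⟨?_, ?_⟩)
    · simpa using tendsto_thetaProd.norm
    · filter_upwards [eventually_cusp_im_pos] with τ hτ
      exact norm_pos_iff.mpr (thetaProd_ne_zero hτ)
  refine (hnum.pos_mul_atTop (by norm_num) hden).congr fun τ => ?_
  rw [thetaInvariant, norm_div, div_eq_mul_inv]

open UpperHalfPlane ModularGroup MatrixGroups in
lemma invariant_of_generators {X : Type*} {f : ℍ → X} (hS : ∀ z, f (S • z) = f z)
    (hT : ∀ z, f (T • z) = f z) (g : SL(2, ℤ)) : ∀ z, f (g • z) = f z := by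
  have hg : g ∈ Subgroup.closure {S, T} := by
    simp [SpecialLinearGroup.SL2Z_generators]
  induction hg using Subgroup.closure_induction with
  | mem x hx =>
    rcases hx with rfl | rfl
    · exact hS
    · exact hT
  | one => simp
  | mul x y _ _ hx hy => intro z; rw [mul_smul, hx, hy]
  | inv x _ hx => intro z; rw [← hx (x⁻¹ • z), smul_inv_smul]

/-- The truncated strip containing the standard fundamental domain up to height `Y`. -/
def fundamentalStrip (Y : ℝ) : Set ℂ := {τ | |τ.re| ≤ 1 / 2 ∧ 1 / 2 ≤ τ.im ∧ τ.im ≤ Y}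

lemma isCompact_fundamentalStrip (Y : ℝ) : IsCompact (fundamentalStrip Y) := by
  have h : fundamentalStrip Y = Set.Icc (-(1 / 2)) (1 / 2) ×ℂ Set.Icc (1 / 2) Y := by
    ext τ
    simp [fundamentalStrip, mem_reProdIm, abs_le]
  rw [h]
  exact isCompact_Icc.reProdIm isCompact_Icc

open UpperHalfPlane ModularGroup MatrixGroups in
/-- Reduction theory for the invariant and for the Petersson norm of the discriminant. -/
lemma exists_reduced {τ : ℂ} (hτ : 0 < τ.im) : ∃ τ' : ℂ, |τ'.re| ≤ 1 / 2 ∧ 1 / 2 ≤ τ'.im ∧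
    thetaInvariant τ' = thetaInvariant τ ∧
    ‖thetaProd τ'‖ * τ'.im ^ 6 = ‖thetaProd τ‖ * τ.im ^ 6 := by
  let f : ℍ → ℂ × ℝ := fun z => (thetaInvariant z, ‖thetaProd z‖ * z.im ^ 6)
  have hS : ∀ z, f (S • z) = f z := by
    intro z
    have h1 : ((S • z : ℍ) : ℂ) = -1 / (z : ℂ) := by
      rw [modular_S_smul]
      change (-(z : ℂ))⁻¹ = _
      rw [inv_neg, neg_div, one_div]
    have h2 : (S • z : ℍ).im = z.im / normSq z := by
      rw [← coe_im, h1, neg_div, neg_im, one_div, inv_im, neg_div, neg_neg]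
      rfl
    have hn : 0 < normSq (z : ℂ) := normSq_pos.mpr z.ne_zero
    have hz : 0 < (z : ℂ).im := z.2
    simp only [f, h1, h2]
    rw [thetaInvariant_inv hz, thetaProd_inv hz, norm_mul, norm_pow]
    have h3 : ‖(z : ℂ)‖ ^ 12 = normSq (z : ℂ) ^ 6 := by
      rw [normSq_eq_norm_sq]; ring
    rw [h3]
    congr 1
    field_simp
  have hT : ∀ z, f (T • z) = f z := by
    intro z
    have h1 : ((T • z : ℍ) : ℂ) = z + 1 := by
      rw [modular_T_smul, UpperHalfPlane.coe_vadd, ofReal_one, add_comm]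
    have h2 : (T • z : ℍ).im = z.im := by
      rw [← coe_im, h1]; simp
    simp only [f, h1, h2, thetaInvariant_add_one, thetaProd_add_one]
  obtain ⟨g, hg⟩ := exists_smul_mem_fd ⟨τ, hτ⟩
  have h := invariant_of_generators hS hT g ⟨τ, hτ⟩
  refine ⟨(g • (⟨τ, hτ⟩ : ℍ) : ℍ), hg.2, ?_, congrArg Prod.fst h, congrArg Prod.snd h⟩
  have h3 := three_le_four_mul_im_sq_of_mem_fd hg
  have hp : 0 < (g • (⟨τ, hτ⟩ : ℍ) : ℍ).im := UpperHalfPlane.im_pos _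
  rw [coe_im]
  nlinarith

lemma exists_im_bound (R : ℝ) : ∃ Y : ℝ, ∀ τ : ℂ, ‖thetaInvariant τ‖ ≤ R → τ.im ≤ Y := by
  have h := tendsto_norm_thetaInvariant.eventually_gt_atTop R
  rw [eventually_comap, eventually_atTop] at h
  obtain ⟨Y, hY⟩ := h
  refine ⟨Y, fun τ hτ => ?_⟩
  by_contra hlt
  exact absurd hτ (not_le.mpr (hY τ.im (not_le.mp hlt).le τ rfl))

lemma differentiableAt_thetaInvariant {τ : ℂ} (hτ : 0 < τ.im) :
    DifferentiableAt ℂ thetaInvariant τ :=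
  (((((differentiableAt_theta2 hτ).pow 8).add ((differentiableAt_theta3 hτ).pow 8)).add
    ((differentiableAt_theta4 hτ).pow 8)).pow 3).div (differentiableAt_thetaProd hτ)
    (thetaProd_ne_zero hτ)

lemma fundamentalStrip_im_pos {Y : ℝ} {τ : ℂ} (h : τ ∈ fundamentalStrip Y) : 0 < τ.im := by
  have := h.2.1
  linarith

/-- The image of the half-plane is open by the open mapping theorem. It is closed because, near any
limit value, preimages can be reduced into one compact strip. Hence it is all of ℂ. -/
lemma thetaInvariant_surjective (w : ℂ) : ∃ τ : ℂ, 0 < τ.im ∧ thetaInvariant τ = w := by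
  let H : Set ℂ := {τ | 0 < τ.im}
  have hopen : IsOpen (thetaInvariant '' H) := by
    have han : AnalyticOnNhd ℂ thetaInvariant H :=
      DifferentiableOn.analyticOnNhd
        (fun τ hτ => (differentiableAt_thetaInvariant hτ).differentiableWithinAt) isOpen_im_pos
    have hconn : IsPreconnected H := (convex_halfSpace_im_gt 0).isPreconnected
    rcases han.is_constant_or_isOpen hconn with ⟨v, hv⟩ | h
    -- A constant invariant would contradict its growth at the cusp.
    · obtain ⟨Y, hY⟩ := exists_im_bound ‖v‖
      exfalso
      have hp : (0 : ℝ) < max Y 0 + 1 := by positivity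
      have h1 : (((max Y 0 + 1 : ℝ) : ℂ) * I) ∈ H := by
        change 0 < (((max Y 0 + 1 : ℝ) : ℂ) * I).im
        rwa [im_ofReal_mul, I_im, mul_one]
      have h2 := hY _ (congrArg norm (hv _ h1)).le
      rw [im_ofReal_mul, I_im, mul_one] at h2
      linarith [le_max_left Y 0]
    · exact h H subset_rfl isOpen_im_pos
  have hclosed : IsClosed (thetaInvariant '' H) := by
    rw [← closure_subset_iff_isClosed]
    intro w hw
    obtain ⟨Y, hY⟩ := exists_im_bound (‖w‖ + 1)
    have hK : IsCompact (thetaInvariant '' fundamentalStrip Y) :=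
      (isCompact_fundamentalStrip Y).image_of_continuousOn fun τ hτ =>
        (differentiableAt_thetaInvariant
          (fundamentalStrip_im_pos hτ)).continuousAt.continuousWithinAt
    have hsub : thetaInvariant '' H ∩ Metric.ball w 1 ⊆ thetaInvariant '' fundamentalStrip Y := by
      rintro _ ⟨⟨τ, hτ, rfl⟩, hball⟩
      obtain ⟨τ', hre, him, hinv, -⟩ := exists_reduced hτ
      refine ⟨τ', ⟨hre, him, hY τ' ?_⟩, hinv⟩
      rw [hinv]
      have h1 := norm_sub_norm_le (thetaInvariant τ) w
      have h2 := mem_ball_iff_norm.mp hball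
      linarith
    have hw' : w ∈ closure (thetaInvariant '' H ∩ Metric.ball w 1) := by
      rw [Set.inter_comm]
      exact Metric.isOpen_ball.inter_closure ⟨Metric.mem_ball_self one_pos, hw⟩
    obtain ⟨τ, hτ, h⟩ := closure_minimal hsub hK.isClosed hw'
    exact ⟨τ, fundamentalStrip_im_pos hτ, h⟩
  have huniv : thetaInvariant '' H = Set.univ :=
    IsClopen.eq_univ ⟨hclosed, hopen⟩ ⟨_, I, by simp [H], rfl⟩
  obtain ⟨τ, hτ, h⟩ := huniv ▸ Set.mem_univ w
  exact ⟨τ, hτ, h⟩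

/-- The Petersson norm of the discriminant is bounded below where the invariant is bounded. -/
lemma exists_le_petersson (R : ℝ) : ∃ ε > 0, ∀ τ : ℂ, 0 < τ.im → ‖thetaInvariant τ‖ ≤ R →
    ε ≤ ‖thetaProd τ‖ * τ.im ^ 6 := by
  obtain ⟨Y, hY⟩ := exists_im_bound R
  have hne : (fundamentalStrip (max Y 1)).Nonempty := ⟨I, by
    simp only [fundamentalStrip, Set.mem_ofPred_eq, I_re, I_im]
    norm_num⟩
  have hcont : ContinuousOn (fun τ : ℂ => ‖thetaProd τ‖ * τ.im ^ 6)
      (fundamentalStrip (max Y 1)) := fun τ hτ =>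
    ((differentiableAt_thetaProd (fundamentalStrip_im_pos hτ)).continuousAt.norm.mul
      (continuous_im.continuousAt.pow 6)).continuousWithinAt
  obtain ⟨τ₀, h₀, hmin⟩ := (isCompact_fundamentalStrip _).exists_isMinOn hne hcont
  have him₀ := fundamentalStrip_im_pos h₀
  refine ⟨‖thetaProd τ₀‖ * τ₀.im ^ 6,
    mul_pos (norm_pos_iff.mpr (thetaProd_ne_zero him₀)) (pow_pos him₀ 6), fun τ hτ hR => ?_⟩
  obtain ⟨τ', hre, him, hinv, hpet⟩ := exists_reduced hτ
  rw [← hpet]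
  exact hmin ⟨hre, him, (hY τ' (hinv ▸ hR)).trans (le_max_left _ _)⟩

/-! ### Values of the modular lambda function -/

/-- The modular lambda function. -/
noncomputable def modularLambda (τ : ℂ) : ℂ := theta2 τ ^ 4 / theta3 τ ^ 4

lemma one_sub_modularLambda {τ : ℂ} (hτ : 0 < τ.im) :
    1 - modularLambda τ = theta4 τ ^ 4 / theta3 τ ^ 4 := by
  have h3 := pow_ne_zero 4 (theta3_ne_zero hτ)
  rw [modularLambda, eq_div_iff h3, sub_mul, div_mul_cancel₀ _ h3]
  linear_combination jacobi_identity hτ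

lemma modularLambda_ne_zero {τ : ℂ} (hτ : 0 < τ.im) : modularLambda τ ≠ 0 :=
  div_ne_zero (pow_ne_zero _ (theta2_ne_zero hτ)) (pow_ne_zero _ (theta3_ne_zero hτ))

lemma one_sub_modularLambda_ne_zero {τ : ℂ} (hτ : 0 < τ.im) : 1 - modularLambda τ ≠ 0 := by
  rw [one_sub_modularLambda hτ]
  exact div_ne_zero (pow_ne_zero _ (theta4_ne_zero hτ)) (pow_ne_zero _ (theta3_ne_zero hτ))

lemma modularLambda_inv {τ : ℂ} (hτ : 0 < τ.im) :
    modularLambda (-1 / τ) = 1 - modularLambda τ := by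
  rw [one_sub_modularLambda hτ, modularLambda, theta2_inv hτ, theta3_inv hτ, mul_pow, mul_pow,
    mul_div_mul_left _ _ (pow_ne_zero 4 (sqrt_factor_ne_zero hτ))]

lemma modularLambda_add_one {τ : ℂ} (hτ : 0 < τ.im) :
    modularLambda (τ + 1) = modularLambda τ / (modularLambda τ - 1) := by
  have h3 := theta3_ne_zero hτ
  have h4 := theta4_ne_zero hτ
  rw [← neg_sub 1 (modularLambda τ), one_sub_modularLambda hτ, modularLambda, modularLambda,
    theta2_add_one_pow_four, theta3_add_one]
  field_simp

lemma thetaInvariant_eq {τ : ℂ} (hτ : 0 < τ.im) :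
    thetaInvariant τ = 8 * (modularLambda τ ^ 2 - modularLambda τ + 1) ^ 3 /
      (modularLambda τ ^ 2 * (1 - modularLambda τ) ^ 2) := by
  have h2 := theta2_ne_zero hτ
  have h3 := theta3_ne_zero hτ
  have h4 := theta4_ne_zero hτ
  have e : 8 * (modularLambda τ ^ 2 - modularLambda τ + 1) ^ 3 =
      (modularLambda τ ^ 2 + 1 + (1 - modularLambda τ) ^ 2) ^ 3 := by ring
  rw [e, one_sub_modularLambda hτ, modularLambda, thetaInvariant, thetaProd]
  field_simp

/-- Klein's invariant is a rational function of λ of degree six whose fibres are the orbits of the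
anharmonic group. The generators y ↦ 1 − y and y ↦ y/(y − 1) are realised by τ ↦ −1/τ and τ ↦ τ + 1,
so hitting the right invariant is enough. -/
lemma modularLambda_surjective {x : ℂ} (h0 : x ≠ 0) (h1 : x ≠ 1) :
    ∃ τ : ℂ, 0 < τ.im ∧ modularLambda τ = x := by
  let L : Set ℂ := {y | ∃ τ : ℂ, 0 < τ.im ∧ modularLambda τ = y}
  have hsub : ∀ y ∈ L, 1 - y ∈ L := by
    rintro _ ⟨τ, hτ, rfl⟩
    exact ⟨-1 / τ, im_neg_one_div_pos hτ, modularLambda_inv hτ⟩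
  have hdiv : ∀ y ∈ L, y / (y - 1) ∈ L := by
    rintro _ ⟨τ, hτ, rfl⟩
    exact ⟨τ + 1, by simpa using hτ, modularLambda_add_one hτ⟩
  have hinv : ∀ y ∈ L, y ≠ 0 → 1 / y ∈ L := by
    intro y hy hy0
    have h := hsub _ (hdiv _ (hsub y hy))
    convert h using 1
    rw [sub_sub_cancel_left]
    field_simp
    ring
  have hx1 : 1 - x ≠ 0 := sub_ne_zero.mpr h1.symm
  obtain ⟨τ, hτ, h⟩ := thetaInvariant_surjective
    (8 * (x ^ 2 - x + 1) ^ 3 / (x ^ 2 * (1 - x) ^ 2))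
  rw [thetaInvariant_eq hτ] at h
  have hy : modularLambda τ ∈ L := ⟨τ, hτ, rfl⟩
  have hy0 := modularLambda_ne_zero hτ
  have hy1 := one_sub_modularLambda_ne_zero hτ
  change x ∈ L
  generalize modularLambda τ = y at *
  rw [div_eq_div_iff (mul_ne_zero (pow_ne_zero _ hy0) (pow_ne_zero _ hy1))
    (mul_ne_zero (pow_ne_zero _ h0) (pow_ne_zero _ hx1))] at h
  -- The cleared difference of the two invariants splits into six factors, one for each element of
  -- the anharmonic group.
  have hprod : (y - x) * ((y - (1 - x)) * ((x * y - 1) * (((1 - x) * y - 1) *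
      ((x * y - x + 1) * ((x - 1) * y - x))))) = 0 := by
    linear_combination -h / 8
  rcases mul_eq_zero.mp hprod with e | e
  · rwa [← sub_eq_zero.mp e]
  rcases mul_eq_zero.mp e with e | e
  · rw [show x = 1 - y by linear_combination e]
    exact hsub y hy
  rcases mul_eq_zero.mp e with e | e
  · rw [show x = 1 / y by rw [eq_div_iff hy0]; linear_combination e]
    exact hinv y hy hy0
  rcases mul_eq_zero.mp e with e | e
  · rw [show x = 1 - 1 / y by field_simp; linear_combination -e]
    exact hsub _ (hinv y hy hy0)
  rcases mul_eq_zero.mp e with e | e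
  · rw [show x = 1 / (1 - y) by rw [eq_div_iff hy1]; linear_combination -e]
    exact hinv _ (hsub y hy) hy1
  · have hy1' : y - 1 ≠ 0 := fun h => hy1 (by linear_combination -h)
    rw [show x = y / (y - 1) by rw [eq_div_iff hy1']; linear_combination e]
    exact hdiv y hy

/-! ### Uniqueness for holomorphic differential equations -/

open Set

/-- Uniqueness along segments for holomorphic solutions of an ordinary differential equation. -/
lemma ode_unique_of_segment {E : Type*} [NormedAddCommGroup E] [NormedSpace ℂ E] {v : ℂ → E → E}
    {f g : ℂ → E} {x y : ℂ} {s : Set E} {K : NNReal}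
    (hv : ∀ z ∈ segment ℝ x y, LipschitzOnWith K (v z) s)
    (hf : ∀ z ∈ segment ℝ x y, HasDerivAt f (v z (f z)) z ∧ f z ∈ s)
    (hg : ∀ z ∈ segment ℝ x y, HasDerivAt g (v z (g z)) z ∧ g z ∈ s)
    (h : f x = g x) : f y = g y := by
  let _ : NormedSpace ℝ E := NormedSpace.restrictScalars ℝ ℂ E
  let p : ℝ → ℂ := fun t => x + t * (y - x)
  have hp : ∀ t ∈ Icc (0 : ℝ) 1, p t ∈ segment ℝ x y := by
    intro t ht
    rw [segment_eq_image']
    exact ⟨t, ht, by simp [p]⟩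
  have hd : ∀ t : ℝ, HasDerivAt p (y - x) t := by
    intro t
    have h1 : HasDerivAt (fun t : ℝ => (t : ℂ)) 1 t := ofRealCLM.hasDerivAt
    simpa only [one_mul] using (h1.mul_const (y - x)).const_add x
  have hcurve : ∀ F : ℂ → E, (∀ z ∈ segment ℝ x y, HasDerivAt F (v z (F z)) z ∧ F z ∈ s) →
      ∀ t ∈ Icc (0 : ℝ) 1, HasDerivAt (F ∘ p) ((y - x) • v (p t) ((F ∘ p) t)) t :=
    fun F hF t ht => (hF _ (hp t ht)).1.scomp t (hd t)
  have hend := ODE_solution_unique_of_mem_Icc_right (K := ‖y - x‖₊ * K)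
    (v := fun t e => (y - x) • v (p t) e) (s := fun _ => s) (f := f ∘ p) (g := g ∘ p)
    (a := 0) (b := 1)
    (fun t ht => by
      have h1 := hv _ (hp t (Ico_subset_Icc_self ht))
      rw [lipschitzOnWith_iff_dist_le_mul] at h1 ⊢
      intro a ha b hb
      rw [dist_eq_norm, ← smul_sub, norm_smul, NNReal.coe_mul, coe_nnnorm, mul_assoc,
        ← dist_eq_norm (v (p t) a)]
      exact mul_le_mul_of_nonneg_left (h1 a ha b hb) (norm_nonneg _))
    (fun t ht => (hcurve f hf t ht).continuousAt.continuousWithinAt)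
    (fun t ht => (hcurve f hf t (Ico_subset_Icc_self ht)).hasDerivWithinAt)
    (fun t ht => (hf _ (hp t (Ico_subset_Icc_self ht))).2)
    (fun t ht => (hcurve g hg t ht).continuousAt.continuousWithinAt)
    (fun t ht => (hcurve g hg t (Ico_subset_Icc_self ht)).hasDerivWithinAt)
    (fun t ht => (hg _ (hp t (Ico_subset_Icc_self ht))).2)
    (by simpa [p] using h)
  simpa [p] using hend (right_mem_Icc.mpr zero_le_one)

lemma isCompact_segment (x y : ℂ) : IsCompact (segment ℝ x y) := by
  rw [segment_eq_image]
  exact isCompact_Icc.image (by fun_prop)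

/-- A solution of a homogeneous linear equation vanishing at a point vanishes on segments. -/
lemma linear_eq_zero_of_segment {g p : ℂ → ℂ} {x y : ℂ}
    (hp : ContinuousOn p (segment ℝ x y))
    (hg : ∀ z ∈ segment ℝ x y, HasDerivAt g (p z * g z) z) (h : g x = 0) : g y = 0 := by
  obtain ⟨C, hC⟩ := (isCompact_segment x y).exists_bound_of_continuousOn hp
  refine ode_unique_of_segment (v := fun z e => p z * e) (g := fun _ => 0) (s := univ)
    (K := C.toNNReal) (fun z hz => ?_) (fun z hz => ⟨hg z hz, mem_univ _⟩)
    (fun z _ => ⟨by simpa using hasDerivAt_const z (0 : ℂ), mem_univ _⟩) h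
  refine LipschitzWith.lipschitzOnWith (LipschitzWith.of_dist_le_mul fun a b => ?_)
  rw [dist_eq_norm, dist_eq_norm, ← mul_sub, norm_mul]
  exact mul_le_mul_of_nonneg_right ((hC z hz).trans (Real.le_coe_toNNReal C)) (norm_nonneg _)

/-- A solution of a homogeneous linear equation on a connected open set which is nonzero somewhere
vanishes nowhere. -/
lemma linear_ne_zero {U : Set ℂ} (hU : IsOpen U) (hconn : IsPreconnected U) {g p : ℂ → ℂ}
    (hp : ContinuousOn p U) (hg : ∀ z ∈ U, HasDerivAt g (p z * g z) z)
    (h : ∃ z ∈ U, g z ≠ 0) : ∀ z ∈ U, g z ≠ 0 := by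
  have hcont : ContinuousOn g U := fun z hz => (hg z hz).continuousAt.continuousWithinAt
  have hopen : IsOpen (U ∩ g ⁻¹' {0}ᶜ) := hcont.isOpen_inter_preimage hU isOpen_compl_singleton
  have hsub : U ⊆ U ∩ g ⁻¹' {0}ᶜ := by
    obtain ⟨z₀, hz₀, hne⟩ := h
    refine hconn.subset_of_closure_inter_subset hopen ⟨z₀, hz₀, hz₀, hne⟩ ?_
    rintro z ⟨hzc, hzU⟩
    refine ⟨hzU, fun hz0 => ?_⟩
    obtain ⟨r, hr, hball⟩ := Metric.isOpen_iff.mp hU z hzU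
    obtain ⟨w, ⟨-, hw⟩, hwz⟩ := Metric.mem_closure_iff.mp hzc r hr
    have hseg : segment ℝ z w ⊆ U := ((convex_ball z r).segment_subset (Metric.mem_ball_self hr)
      (by rwa [Metric.mem_ball, dist_comm])).trans hball
    exact hw (linear_eq_zero_of_segment (hp.mono hseg) (fun t ht => hg t (hseg ht)) hz0)
  exact fun z hz => (hsub hz).2

/-- The right-hand side of Jacobi's system. -/
def jacobiField (y : ℂ × ℂ × ℂ × ℂ) : ℂ × ℂ × ℂ × ℂ :=
  (2 * y.1 ^ 2 * y.2.1, y.2.2.2 * y.1 ^ 3, -16 * y.2.2.2 * y.1 ^ 2, y.2.2.1 * y.2.2.2 * y.1 ^ 2)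

lemma contDiff_jacobiField : ContDiff ℝ 1 jacobiField := by
  unfold jacobiField
  fun_prop

section Solutions

variable {U : Set ℂ} {A B a b : ℂ → ℂ}

lemma IsSolutionOn.hasDerivAt (h : IsSolutionOn U A B a b) {z : ℂ} (hz : z ∈ U) :
    HasDerivAt (fun t => (A t, B t, a t, b t)) (jacobiField (A z, B z, a z, b z)) z := by
  obtain ⟨h1, h2, h3, h4⟩ := h z hz
  exact h1.prodMk (h2.prodMk (h3.prodMk h4))

lemma IsSolutionOn.mono (h : IsSolutionOn U A B a b) {V : Set ℂ} (hV : V ⊆ U) :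
    IsSolutionOn V A B a b := fun z hz => h z (hV hz)

/-- Two solutions of Jacobi's system agreeing at one end of a segment agree at the other. -/
lemma IsSolutionOn.eq_of_segment {A' B' a' b' : ℂ → ℂ} {x y : ℂ}
    (h : IsSolutionOn (segment ℝ x y) A B a b) (h' : IsSolutionOn (segment ℝ x y) A' B' a' b')
    (he : (A x, B x, a x, b x) = (A' x, B' x, a' x, b' x)) :
    (A y, B y, a y, b y) = (A' y, B' y, a' y, b' y) := by
  have hbd : ∀ {A B a b : ℂ → ℂ}, IsSolutionOn (segment ℝ x y) A B a b →
      ∃ C, ∀ z ∈ segment ℝ x y, ‖(A z, B z, a z, b z)‖ ≤ C := fun h =>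
    (isCompact_segment x y).exists_bound_of_continuousOn fun z hz =>
      (h.hasDerivAt hz).continuousAt.continuousWithinAt
  obtain ⟨C, hC⟩ := hbd h
  obtain ⟨C', hC'⟩ := hbd h'
  -- Both solutions stay in this ball along the compact segment, and the polynomial field is
  -- Lipschitz on it.
  let s : Set (ℂ × ℂ × ℂ × ℂ) := Metric.closedBall 0 (max C C')
  obtain ⟨K, hK⟩ := contDiff_jacobiField.contDiffOn.exists_lipschitzOnWith one_ne_zero
    (convex_closedBall (0 : ℂ × ℂ × ℂ × ℂ) (max C C')) (isCompact_closedBall _ _)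
  exact ode_unique_of_segment (v := fun _ => jacobiField) (f := fun t => (A t, B t, a t, b t))
    (g := fun t => (A' t, B' t, a' t, b' t)) (s := s) (fun _ _ => hK)
    (fun z hz => ⟨h.hasDerivAt hz, mem_closedBall_zero_iff.mpr
      ((hC z hz).trans (le_max_left _ _))⟩)
    (fun z hz => ⟨h'.hasDerivAt hz, mem_closedBall_zero_iff.mpr
      ((hC' z hz).trans (le_max_right _ _))⟩) he

/-- The fourth equation is linear in b, with coefficient aA². -/
lemma IsSolutionOn.b_ne_zero (h : IsSolutionOn U A B a b) (hU : IsOpen U)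
    (hconn : IsPreconnected U) (h0 : ∃ z ∈ U, b z ≠ 0) : ∀ z ∈ U, b z ≠ 0 :=
  linear_ne_zero hU hconn (p := fun z => a z * A z ^ 2)
    (fun z hz => ((h z hz).2.2.1.continuousAt.mul
      ((h z hz).1.continuousAt.pow 2)).continuousWithinAt)
    (fun z hz => (h z hz).2.2.2.congr_deriv (by ring)) h0

end Solutions

/-! ### The boundary of the time domain -/

open ComplexConjugate

section TimeDomain

variable {α β γ δ h : ℂ}

/-- The real quadratic function of `h` whose positivity defines the time domain. -/
def mobiusForm (α β γ δ h : ℂ) : ℝ := ((α * h + β) * conj (γ * h + δ)).im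

lemma mobius_im (α β γ δ h : ℂ) :
    (mobius α β γ δ h).im = mobiusForm α β γ δ h / normSq (γ * h + δ) := by
  rw [mobius, mobiusForm, div_eq_mul_inv, inv_def, ← mul_assoc, im_mul_ofReal,
    div_eq_mul_inv]

lemma mem_timeDomain_iff : h ∈ timeDomain α β γ δ ↔ 0 < mobiusForm α β γ δ h := by
  constructor
  · rintro ⟨hs, him⟩
    rw [mobius_im] at him
    exact (div_pos_iff_of_pos_right (normSq_pos.mpr hs)).mp him
  · intro hpos
    have hs : γ * h + δ ≠ 0 := by
      intro h0
      rw [mobiusForm, h0] at hpos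
      simp at hpos
    refine ⟨hs, ?_⟩
    rw [mobius_im]
    exact div_pos hpos (normSq_pos.mpr hs)

lemma continuous_mobiusForm (α β γ δ : ℂ) : Continuous (mobiusForm α β γ δ) := by
  unfold mobiusForm
  fun_prop

lemma modularLambda_mul_one_sub {τ : ℂ} (hτ : 0 < τ.im) :
    modularLambda τ * (1 - modularLambda τ) = theta2 τ ^ 4 * theta4 τ ^ 4 / theta3 τ ^ 8 := by
  have h3 := theta3_ne_zero hτ
  rw [one_sub_modularLambda hτ, modularLambda]
  field_simp

lemma sola_eq (c α β γ δ h : ℂ) :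
    sola c α β γ δ h = c - 2 * c * modularLambda (mobius α β γ δ h) := rfl

lemma solb_eq {c : ℂ} (hh : h ∈ timeDomain α β γ δ) : solb c α β γ δ h =
    c ^ 2 / 8 * (modularLambda (mobius α β γ δ h) * (1 - modularLambda (mobius α β γ δ h))) := by
  rw [modularLambda_mul_one_sub hh.2, solb]

/-- Since λ² − λ + 1 = 1 − λ(1 − λ), the invariant depends only on λ(1 − λ) = 8b/c². It therefore
stays bounded near a point where b is continuous and nonzero. -/
lemma thetaInvariant_mobius {c : ℂ} (hc : c ≠ 0) (hh : h ∈ timeDomain α β γ δ) :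
    thetaInvariant (mobius α β γ δ h) =
      8 * (1 - 8 * solb c α β γ δ h / c ^ 2) ^ 3 / (8 * solb c α β γ δ h / c ^ 2) ^ 2 := by
  have h0 := modularLambda_ne_zero hh.2
  have h1 := one_sub_modularLambda_ne_zero hh.2
  rw [thetaInvariant_eq hh.2, solb_eq hh]
  generalize modularLambda (mobius α β γ δ h) = x at *
  have e : 8 * (c ^ 2 / 8 * (x * (1 - x))) / c ^ 2 = x * (1 - x) := by field_simp
  rw [e, mul_pow]
  congr 3
  ring

lemma thetaProd_mobius {c ρ : ℂ} (hc : c ≠ 0) (hρ : ρ ≠ 0) (hh : h ∈ timeDomain α β γ δ) :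
    thetaProd (mobius α β γ δ h) = 64 / (ρ ^ 12 * c ^ 4) *
      (solA ρ α β γ δ h ^ 12 * solb c α β γ δ h ^ 2) * (γ * h + δ) ^ 12 := by
  have h3 := theta3_ne_zero hh.2
  have hs := hh.1
  rw [thetaProd, solA, solb]
  field_simp
  norm_num

/-- The powers of |γh + δ| cancel, and what remains is continuous up to and across the boundary of
the time domain wherever `A` and `b` are replaced by continuous functions. -/
lemma petersson_mobius {c ρ : ℂ} (hc : c ≠ 0) (hρ : ρ ≠ 0) (hh : h ∈ timeDomain α β γ δ) :
    ‖thetaProd (mobius α β γ δ h)‖ * (mobius α β γ δ h).im ^ 6 =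
      ‖64 / (ρ ^ 12 * c ^ 4) * (solA ρ α β γ δ h ^ 12 * solb c α β γ δ h ^ 2)‖ *
        mobiusForm α β γ δ h ^ 6 := by
  have hn : ‖γ * h + δ‖ ≠ 0 := norm_ne_zero_iff.mpr hh.1
  rw [thetaProd_mobius hc hρ hh, mobius_im, norm_mul, norm_pow, normSq_eq_norm_sq]
  field_simp

end TimeDomain

/-! ### Matching initial values and continuation -/

/-- A theta solution with prescribed nondegenerate initial values. -/
lemma exists_solution_parameters {h₀ A₀ B₀ a₀ b₀ : ℂ} (hA : A₀ ≠ 0) (hb : b₀ ≠ 0)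
    (hc : a₀ ^ 2 + 32 * b₀ ≠ 0) :
    ∃ c α β γ δ ρ σ : ℂ, c ≠ 0 ∧ α * δ - β * γ = 1 ∧ IsRootPair c ρ σ ∧
      h₀ ∈ timeDomain α β γ δ ∧ a₀ = sola c α β γ δ h₀ ∧ b₀ = solb c α β γ δ h₀ ∧
      A₀ = solA ρ α β γ δ h₀ ∧ B₀ = solB σ α β γ δ h₀ := by
  have hπ : (Real.pi : ℂ) ≠ 0 := by exact_mod_cast Real.pi_ne_zero
  obtain ⟨c, hc2⟩ := IsAlgClosed.exists_pow_nat_eq (a₀ ^ 2 + 32 * b₀) two_pos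
  have hc0 : c ≠ 0 := by
    rintro rfl
    exact hc (by rw [← hc2]; ring)
  obtain ⟨ρ, hρ2⟩ := IsAlgClosed.exists_pow_nat_eq (Real.pi * I / c) two_pos
  have hρ0 : ρ ≠ 0 := by
    rintro rfl
    have : (Real.pi : ℂ) * I / c ≠ 0 := div_ne_zero (mul_ne_zero hπ I_ne_zero) hc0
    exact this (by rw [← hρ2]; ring)
  have hroot : IsRootPair c ρ (I / Real.pi / ρ) := by
    refine ⟨hρ2, ?_, mul_div_cancel₀ _ hρ0⟩
    rw [div_pow, hρ2]
    have := I_ne_zero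
    field_simp
  -- The formula for a forces λ(T) = (c − a₀)/(2c); this product being 32b₀ ≠ 0 excludes the omitted
  -- values 0 and 1.
  have hprod : (c - a₀) * (c + a₀) ≠ 0 := by
    rw [show (c - a₀) * (c + a₀) = 32 * b₀ by linear_combination hc2]
    exact mul_ne_zero (by norm_num) hb
  have hx0 : (c - a₀) / (2 * c) ≠ 0 :=
    div_ne_zero (left_ne_zero_of_mul hprod) (mul_ne_zero two_ne_zero hc0)
  have hx1 : (c - a₀) / (2 * c) ≠ 1 := by
    intro h
    rw [div_eq_one_iff_eq (mul_ne_zero two_ne_zero hc0)] at h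
    exact right_ne_zero_of_mul hprod (by linear_combination -h)
  obtain ⟨τ, hτ, hlam⟩ := modularLambda_surjective hx0 hx1
  have h3 := theta3_ne_zero hτ
  -- Here s is to be γh₀ + δ, as dictated by A₀. Solving `solB_eq` for γ gives the next choice. With
  -- αh₀ + β = τs, the determinant is αs − γτs, which determines α.
  obtain ⟨s, hs⟩ : ∃ s, s = ρ * theta3 τ ^ 2 / A₀ := ⟨_, rfl⟩
  have hs0 : s ≠ 0 := by
    rw [hs]; exact div_ne_zero (mul_ne_zero hρ0 (pow_ne_zero _ h3)) hA
  obtain ⟨γ, hγ⟩ : ∃ γ, γ = 2 * logDeriv theta3 τ / s - 2 * ρ * theta3 τ ^ 2 * B₀ := ⟨_, rfl⟩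
  let α := (1 + γ * τ * s) / s
  have hden : γ * h₀ + (s - γ * h₀) = s := by ring
  have hnum : α * h₀ + (τ * s - α * h₀) = τ * s := by ring
  have hmob : mobius α (τ * s - α * h₀) γ (s - γ * h₀) h₀ = τ := by
    rw [mobius, hden, hnum, mul_div_cancel_right₀ _ hs0]
  have hmem : h₀ ∈ timeDomain α (τ * s - α * h₀) γ (s - γ * h₀) :=
    ⟨by rwa [hden], by rwa [hmob]⟩
  refine ⟨c, α, τ * s - α * h₀, γ, s - γ * h₀, ρ, I / Real.pi / ρ, hc0, ?_, hroot, hmem, ?_, ?_,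
    ?_, ?_⟩
  · simp only [α]
    field_simp
    ring
  · rw [sola_eq, hmob, hlam]
    field_simp
    ring
  · rw [solb_eq hmem, hmob, hlam]
    field_simp
    linear_combination -hc2
  · rw [solA, hmob, hden, hs]
    field_simp
  · rw [solB_eq hroot hmem, hmob, hden, hγ]
    field_simp
    ring

/-- A solution agreeing with a theta solution at a point agrees with it everywhere. -/
lemma eqOn_of_eq {U : Set ℂ} {A B a b : ℂ → ℂ} (hU : IsOpen U) (hconn : IsPreconnected U)
    (hsol : IsSolutionOn U A B a b) (hb : ∀ h ∈ U, b h ≠ 0)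
    {c α β γ δ ρ σ h₀ : ℂ} (hc : c ≠ 0) (hdet : α * δ - β * γ = 1) (hroot : IsRootPair c ρ σ)
    (h₀U : h₀ ∈ U) (h₀D : h₀ ∈ timeDomain α β γ δ)
    (he : (A h₀, B h₀, a h₀, b h₀) = (solA ρ α β γ δ h₀, solB σ α β γ δ h₀, sola c α β γ δ h₀,
      solb c α β γ δ h₀)) :
    ∀ h ∈ U, h ∈ timeDomain α β γ δ ∧ (A h, B h, a h, b h) = (solA ρ α β γ δ h, solB σ α β γ δ h,
      sola c α β γ δ h, solb c α β γ δ h) := by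
  have hth := isSolutionOn_timeDomain hc hdet hroot
  let V : Set ℂ := {h | h ∈ U ∧ h ∈ timeDomain α β γ δ ∧ (A h, B h, a h, b h) =
    (solA ρ α β γ δ h, solB σ α β γ δ h, sola c α β γ δ h, solb c α β γ δ h)}
  have hVopen : IsOpen V := by
    rw [Metric.isOpen_iff]
    rintro h ⟨hhU, hhD, hhe⟩
    obtain ⟨r, hr, hball⟩ := Metric.isOpen_iff.mp (hU.inter (isOpen_timeDomain α β γ δ)) h ⟨hhU, hhD⟩
    refine ⟨r, hr, fun z hz => ⟨(hball hz).1, (hball hz).2, ?_⟩⟩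
    have hseg : segment ℝ h z ⊆ U ∩ timeDomain α β γ δ :=
      ((convex_ball h r).segment_subset (Metric.mem_ball_self hr) hz).trans hball
    exact IsSolutionOn.eq_of_segment (hsol.mono (hseg.trans inter_subset_left))
      (hth.mono (hseg.trans inter_subset_right)) hhe
  have hVU : U ⊆ V := by
    refine hconn.subset_of_closure_inter_subset hVopen ⟨h₀, h₀U, h₀U, h₀D, he⟩ ?_
    rintro h ⟨hcl, hhU⟩
    have hne : (𝓝[V] h).NeBot := mem_closure_iff_nhdsWithin_neBot.mp hcl
    obtain ⟨dA, dB, da, db⟩ := hsol h hhU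
    have hρ := hroot.ne_zero
    -- On V the functions J and G are the invariant and the Petersson norm at `T`, written through
    -- the given solution; unlike those, they are continuous at the limit point h even before h is
    -- known to lie in the time domain.
    let J : ℂ → ℂ := fun z => 8 * (1 - 8 * b z / c ^ 2) ^ 3 / (8 * b z / c ^ 2) ^ 2
    have hJ : ContinuousAt J h := by
      have hb8 : ContinuousAt (fun z => 8 * b z / c ^ 2) h :=
        (db.continuousAt.const_mul 8).div_const _
      refine (((hb8.const_sub 1).pow 3).const_mul 8).div (hb8.pow 2) ?_
      exact pow_ne_zero _ (div_ne_zero (mul_ne_zero (by norm_num) (hb h hhU)) (pow_ne_zero _ hc))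
    obtain ⟨ε, hε, hle⟩ := exists_le_petersson (‖J h‖ + 1)
    let G : ℂ → ℝ := fun z => ‖64 / (ρ ^ 12 * c ^ 4) * (A z ^ 12 * b z ^ 2)‖ *
      mobiusForm α β γ δ z ^ 6
    have hG : ContinuousAt G h :=
      (((dA.continuousAt.pow 12).mul (db.continuousAt.pow 2)).const_mul _).norm.mul
        ((continuous_mobiusForm α β γ δ).continuousAt.pow 6)
    have hbound : ∀ᶠ z in 𝓝[V] h, ε ≤ G z := by
      have h1 : ∀ᶠ z in 𝓝[V] h, ‖J z‖ < ‖J h‖ + 1 :=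
        (hJ.norm.eventually_lt_const (lt_add_one _)).filter_mono nhdsWithin_le_nhds
      filter_upwards [h1, self_mem_nhdsWithin] with z hz hzV
      obtain ⟨-, hzD, hze⟩ := hzV
      simp only [Prod.mk.injEq] at hze
      obtain ⟨eA, -, -, eb⟩ := hze
      have h2 : ‖thetaInvariant (mobius α β γ δ z)‖ ≤ ‖J h‖ + 1 := by
        rw [thetaInvariant_mobius hc hzD, ← eb]
        exact hz.le
      have h3 := hle _ hzD.2 h2
      rwa [petersson_mobius hc hρ hzD, ← eA, ← eb] at h3
    have hGh : ε ≤ G h := ge_of_tendsto (hG.tendsto.mono_left nhdsWithin_le_nhds) hbound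
    have hQ0 : 0 ≤ mobiusForm α β γ δ h :=
      ge_of_tendsto ((continuous_mobiusForm α β γ δ).continuousAt.tendsto.mono_left
        nhdsWithin_le_nhds)
        (eventually_nhdsWithin_of_forall fun z (hzV : z ∈ V) => (mem_timeDomain_iff.mp hzV.2.1).le)
    have hhD : h ∈ timeDomain α β γ δ := by
      rw [mem_timeDomain_iff]
      -- If the form vanished at h, then G h = 0, against the lower bound ε.
      refine hQ0.lt_of_ne fun h0 => ?_
      simp only [G, ← h0] at hGh
      norm_num at hGh
      linarith
    refine ⟨hhU, hhD, ?_⟩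
    refine tendsto_nhds_unique_of_eventuallyEq (l := 𝓝[V] h)
      ((hsol.hasDerivAt hhU).continuousAt.tendsto.mono_left nhdsWithin_le_nhds)
      ((hth.hasDerivAt hhD).continuousAt.tendsto.mono_left nhdsWithin_le_nhds) ?_
    filter_upwards [self_mem_nhdsWithin] with z hzV
    exact hzV.2.2
  exact fun h hh => (hVU hh).2

end JacobiSystem

theorem theorem4 :
    -- every choice of the constants gives a solution, with first integral `c² = a² + 32b`
    (∀ c α β γ δ ρ σ : ℂ, c ≠ 0 → α * δ - β * γ = 1 → JacobiSystem.IsRootPair c ρ σ →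
      (JacobiSystem.timeDomain α β γ δ).Nonempty ∧
      JacobiSystem.IsSolutionOn (JacobiSystem.timeDomain α β γ δ)
        (JacobiSystem.solA ρ α β γ δ) (JacobiSystem.solB σ α β γ δ)
        (JacobiSystem.sola c α β γ δ) (JacobiSystem.solb c α β γ δ) ∧
      ∀ h ∈ JacobiSystem.timeDomain α β γ δ,
        c ^ 2 = JacobiSystem.sola c α β γ δ h ^ 2 + 32 * JacobiSystem.solb c α β γ δ h ∧
        JacobiSystem.solA ρ α β γ δ h ≠ 0 ∧ JacobiSystem.solb c α β γ δ h ≠ 0) ∧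
    -- every nondegenerate solution on a connected open set is of this form, on the whole set
    (∀ (U : Set ℂ) (A B a b : ℂ → ℂ), IsOpen U → IsPreconnected U →
      JacobiSystem.IsSolutionOn U A B a b →
      (∃ h₀ ∈ U, A h₀ ≠ 0 ∧ b h₀ ≠ 0 ∧ a h₀ ^ 2 + 32 * b h₀ ≠ 0) →
      ∃ c α β γ δ ρ σ : ℂ, c ≠ 0 ∧ α * δ - β * γ = 1 ∧ JacobiSystem.IsRootPair c ρ σ ∧
        U ⊆ JacobiSystem.timeDomain α β γ δ ∧
        ∀ h ∈ U,
          c ^ 2 = a h ^ 2 + 32 * b h ∧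
          a h = JacobiSystem.sola c α β γ δ h ∧
          b h = JacobiSystem.solb c α β γ δ h ∧
          A h = JacobiSystem.solA ρ α β γ δ h ∧
          B h = JacobiSystem.solB σ α β γ δ h) := by
  refine ⟨fun c α β γ δ ρ σ hc hdet hroot => ⟨JacobiSystem.timeDomain_nonempty hdet,
    JacobiSystem.isSolutionOn_timeDomain hc hdet hroot, fun h hh =>
      ⟨JacobiSystem.sola_sq_add hh, JacobiSystem.solA_ne_zero hroot.ne_zero hh,
        JacobiSystem.solb_ne_zero hc hh⟩⟩, ?_⟩
  rintro U A B a b hU hconn hsol ⟨h₀, h₀U, hA, hb, hc0⟩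
  obtain ⟨c, α, β, γ, δ, ρ, σ, hc, hdet, hroot, h₀D, ea, eb, eA, eB⟩ :=
    JacobiSystem.exists_solution_parameters (h₀ := h₀) (B₀ := B h₀) hA hb hc0
  have key := JacobiSystem.eqOn_of_eq hU hconn hsol
    (hsol.b_ne_zero hU hconn ⟨h₀, h₀U, hb⟩)
    hc hdet hroot h₀U h₀D (by rw [← ea, ← eb, ← eA, ← eB])
  refine ⟨c, α, β, γ, δ, ρ, σ, hc, hdet, hroot, fun h hh => (key h hh).1, fun h hh => ?_⟩
  obtain ⟨hhD, he⟩ := key h hh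
  simp only [Prod.mk.injEq] at he
  obtain ⟨e1, e2, e3, e4⟩ := he
  exact ⟨by rw [e3, e4]; exact JacobiSystem.sola_sq_add hhD, e3, e4, e1, e2⟩
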